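/- Let $\lambda>0$ and let $f:[0,\infty)\to[0,\infty)$ be monotonically increasing (not necessarily strictly) and not identically zero. Consider the following frog model with drift on $\mathbb{R}$. At time $0$ there is one active frog, located at the origin, and there are sleeping frogs located at the points of a Poisson process on $[0,\infty)$ with intensity $f(t)\,dt$. Every active frog moves as a Brownian motion with leftward drift $\lambda$, that is, after having been active for a time $u$ its displacement from its starting point is $B_u-\lambda u$, where $B$ is a standard Brownian motion. A sleeping frog does not move; it becomes active as soon as an active frog arrives at its location. The Brownian motions of different frogs are independent of each other and of the Poisson process. The model is called transient if the probability that infinitely many different frogs hit the origin is $0$. Then the model is transient if and only if $$\int_0^\infty e^{-\frac{f(t)}{2\lambda}}\,f(t)\,dt=\infty .$$ -/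

import Mathlib

open MeasureTheory ProbabilityTheory Set
open scoped NNReal ENNReal

namespace FrogModel

/-! ### Poisson processes -/

/-- The number (in `ℕ∞`) of points of the sequence `x` that lie in `B`, with multiplicity. -/
noncomputable def pointCount (x : ℕ → ℝ) (B : Set ℝ) : ℕ∞ :=
  {n | x n ∈ B}.encard

/-- The random points `X 0, X 1, …` are the points, listed from left to right, of a Poisson process
on `ℝ` with intensity measure `Λ`: the number of points in a measurable set `B` with `Λ B < ∞`
is Poisson distributed with mean `Λ B`, and the numbers of points in finitely many pairwise
disjoint measurable sets are independent.
(The points are listed by `ℕ`, so this is meant for intensity measures of infinite total mass,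
for which there are almost surely infinitely many points.) -/
structure IsPoissonProcess {Ω : Type*} [MeasurableSpace Ω] (X : ℕ → Ω → ℝ) (Λ : Measure ℝ)
    (P : Measure Ω) : Prop where
  measurable : ∀ n, Measurable (X n)
  strictMono : ∀ᵐ ω ∂P, StrictMono (fun n => X n ω)
  count_law : ∀ B : Set ℝ, MeasurableSet B → Λ B ≠ ∞ →
    HasLaw (fun ω => pointCount (fun n => X n ω) B)
      ((poissonMeasure (Λ B).toNNReal).map (Nat.cast : ℕ → ℕ∞)) P
  count_indep : ∀ (m : ℕ) (B : Fin m → Set ℝ), (∀ k, MeasurableSet (B k)) →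
    Pairwise (fun k l => Disjoint (B k) (B l)) →
    iIndepFun (fun k ω => pointCount (fun n => X n ω) (B k)) P

/-- The measure `f(t) dt` on `[0, ∞)`, seen as a measure on `ℝ`. -/
noncomputable def intensity (f : ℝ → ℝ) : Measure ℝ :=
  (volume.restrict (Ici 0)).withDensity (fun t => ENNReal.ofReal (f t))

/-! ### The dynamics of the frogs, for given starting points and given displacements

Frog `i` starts (active or asleep) at `x i`, and `Y i u` is its displacement from `x i` once it has
been active for a time `u`. Frog `0` is the one that is active at time `0`. -/

/-- The time that frog `i`, once active, needs to arrive at the starting point of frog `j`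
(`∞` if it never does). -/
noncomputable def passageTime (x : ℕ → ℝ) (Y : ℕ → ℝ≥0 → ℝ) (i j : ℕ) : ℝ≥0∞ :=
  ⨅ (u : ℝ≥0) (_ : x i + Y i u = x j), (u : ℝ≥0∞)

/-- The first time at which frog `j` is hit through a chain of `n` successive awakenings
that starts from frog `0`. -/
noncomputable def chainTime (x : ℕ → ℝ) (Y : ℕ → ℝ≥0 → ℝ) : ℕ → ℕ → ℝ≥0∞
  | 0, j => if j = 0 then 0 else ∞
  | n + 1, j => ⨅ i, chainTime x Y n i + passageTime x Y i j

/-- The time at which frog `j` becomes active: frog `0` is active from time `0` on, and any other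
frog wakes up as soon as an active frog arrives at its starting point (`∞` if none ever does). -/
noncomputable def activationTime (x : ℕ → ℝ) (Y : ℕ → ℝ≥0 → ℝ) (j : ℕ) : ℝ≥0∞ :=
  ⨅ n, chainTime x Y n j

/-- The position of frog `j` at time `t`. -/
noncomputable def position (x : ℕ → ℝ) (Y : ℕ → ℝ≥0 → ℝ) (j : ℕ) (t : ℝ≥0) : ℝ :=
  if activationTime x Y j ≤ t then x j + Y j (t - (activationTime x Y j).toNNReal) else x j

/-- Frog `j` hits the origin at some time at which it is active. -/
def HitsOrigin (x : ℕ → ℝ) (Y : ℕ → ℝ≥0 → ℝ) (j : ℕ) : Prop :=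
  ∃ t : ℝ≥0, activationTime x Y j ≤ t ∧ position x Y j t = 0

/-! ### The frog model with drift on `ℝ` -/

/-- The starting points of all frogs: frog `0` starts at the origin, and frog `n + 1` is the
sleeping frog at `X n`. -/
def start {Ω : Type*} (X : ℕ → Ω → ℝ) (ω : Ω) : ℕ → ℝ
  | 0 => 0
  | n + 1 => X n ω

/-- Brownian motion with leftward drift `drift`: frog `i`, once it has been active for a time `u`,
is displaced by `W i u - drift * u`. -/
def displacement {Ω : Type*} (drift : ℝ) (W : ℕ → ℝ≥0 → Ω → ℝ) (ω : Ω) (i : ℕ) (u : ℝ≥0) : ℝ :=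
  W i u ω - drift * u

/-- The random input of the frog model with sleeping frogs of intensity `f` on `[0, ∞)`: the
positions `X n` of the sleeping frogs form a Poisson process with intensity `f(t) dt` on `[0, ∞)`,
the `W i` are independent standard Brownian motions (one for each frog), and the Brownian motions
are independent of the positions of the sleeping frogs. -/
structure IsFrogInput {Ω : Type*} [MeasurableSpace Ω] (f : ℝ → ℝ) (X : ℕ → Ω → ℝ)
    (W : ℕ → ℝ≥0 → Ω → ℝ) (P : Measure Ω) : Prop where
  poisson : IsPoissonProcess X (intensity f) P
  measurable : ∀ i t, Measurable (W i t)
  brownian : ∀ i, IsBrownianReal (W i) P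
  indep : iIndepFun (fun (i : ℕ) (ω : Ω) (t : ℝ≥0) => W i t ω) P
  indep_poisson : IndepFun (fun (ω : Ω) (n : ℕ) => X n ω)
    (fun (ω : Ω) (i : ℕ) (t : ℝ≥0) => W i t ω) P

/-- The model is transient: the probability that infinitely many different frogs hit the origin
is `0`. -/
def Transient {Ω : Type*} [MeasurableSpace Ω] (drift : ℝ) (X : ℕ → Ω → ℝ)
    (W : ℕ → ℝ≥0 → Ω → ℝ) (P : Measure Ω) : Prop :=
  P {ω | {j | HitsOrigin (start X ω) (displacement drift W ω) j}.Infinite} = 0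

end FrogModel

/-!
Every woken frog has drift to the left and hits the origin, so the model is transient if and only if
almost surely some frog is never woken. By continuity of the paths, all frogs are woken if and only
if the intervals `[x i, x i + M i]` cover the starting points of all the other frogs, from left to
right, where `x i` is the starting point of frog `i` and `M i` its largest displacement. The process
of intervals covering a point is a queue with arrival rate `f`, independent service times `M i` and
infinitely many servers, and the question is whether its first busy period is infinite.

The law of `M i` is exponential with parameter `μ = 2 * drift` (`measure_pathSup_le`). With
`Y u = W u - drift * u`, the weight `exp (μ * (Y T - Y u))` has mean one given the path up to time
`u`. On a dyadic grid this expresses the probability that a level `r` is reached by the integral of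
`exp (μ * Y T) * exp (-μ * Y τ)` over this event, where `τ` is the passage time. As `Y τ ≥ r`, the
upper bound is immediate; as the overshoot vanishes on fine grids and `exp (μ * Y T)` puts little
mass on paths below `r` at a large time `T`, so is the lower one.

The half-line is cut at points `a 0 = 0 < a 1 < …` into intervals that have mass one for `f(t) dt`
(`exists_bins`). Since `f` is increasing, the gaps `a (k + 1) - a k` decrease, and the integral is
infinite if and only if `∑ exp (-f (a k) / μ)` is. The largest displacement `R l` of the frogs that
start in interval `l` has `P (R l ≤ r) = exp (-exp (-μ r))`, and the `R l` are independent
(`iIndepFun_reach`). Moving all frogs to the left or right endpoints of their intervals gives the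
two events that decide the matter.

* If the sum diverges, let `D k` be the event that no interval `l < k` reaches `a k`, even when its
  frogs are moved to `a (l + 1)`. Then `P (D k) ≥ exp (-1 - f (a k) / μ)`. As gaps
  decrease, after an occurrence at `k` the later events are dominated by a fresh copy, which gives a
  renewal inequality, and the divergence of `∑ P (D k)` forces the `D k` to occur arbitrarily late
  (`ae_exists_gapEvent`). One occurrence beyond the reach of frog `0` ends the spread of activity.
* If the sum converges, let `F k` be the event that no interval `l < k` covers interval `k`, even
  when its frogs are moved to `a l`. A discrete version of the equation `m' = f - μ m` for the mean
  number `m` of intervals covering a point shows that `∑ P (F k)` converges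
  (`summable_exp_neg_sum`). With positive probability, frog `0` covers the first `K` intervals
  and no `F k` with `k ≥ K` occurs, and then all frogs are woken.
-/

namespace FrogModel

open Filter Topology

/-! ### The supremum of a Brownian motion with drift -/

section Brownian

variable {Ω : Type*} [MeasurableSpace Ω] {P : Measure Ω}
  {W : ℝ≥0 → Ω → ℝ} {d : ℝ}

lemma lintegral_exp_mul_brownian (hW : IsPreBrownianReal W P) (a : ℝ) (t : ℝ≥0) :
    ∫⁻ ω, ENNReal.ofReal (Real.exp (a * W t ω)) ∂P = ENNReal.ofReal (Real.exp (a ^ 2 * t / 2)) := by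
  rw [(hW.hasLaw_eval t).lintegral_comp (f := fun x => ENNReal.ofReal (Real.exp (a * x)))
    (by fun_prop), ← ofReal_integral_eq_lintegral_ofReal (integrable_exp_mul_gaussianReal a)
    (ae_of_all _ fun _ => (Real.exp_pos _).le)]
  have := congrFun (mgf_fun_id_gaussianReal (μ := 0) (v := t)) a
  rw [mgf] at this
  rw [this]
  congr 2
  ring

lemma lintegral_exp_mul_drifted (hW : IsPreBrownianReal W P) (a d : ℝ) (t : ℝ≥0) :
    ∫⁻ ω, ENNReal.ofReal (Real.exp (a * (W t ω - d * t))) ∂P =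
      ENNReal.ofReal (Real.exp ((a ^ 2 / 2 - a * d) * t)) := by
  have : ∀ ω, ENNReal.ofReal (Real.exp (a * (W t ω - d * t))) =
      ENNReal.ofReal (Real.exp (-(a * d * t))) * ENNReal.ofReal (Real.exp (a * W t ω)) := fun ω => by
    rw [← ENNReal.ofReal_mul (Real.exp_pos _).le, ← Real.exp_add]
    congr 2; ring
  simp_rw [this]
  rw [lintegral_const_mul' _ _ ENNReal.ofReal_ne_top, lintegral_exp_mul_brownian hW,
    ← ENNReal.ofReal_mul (Real.exp_pos _).le, ← Real.exp_add]
  congr 2; ring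

/-- The exponential martingale `exp (2 d (W t - d t))` has conditionally mean one increments given
the path up to time `t`. -/
lemma setLIntegral_exp_increment (hW : IsPreBrownianReal W P) (hm : ∀ t, Measurable (W t))
    {t T : ℝ≥0} (htT : t ≤ T) {S : Set (Iic t → ℝ)} (hS : MeasurableSet S) :
    ∫⁻ ω in (fun ω (s : Iic t) => W s ω) ⁻¹' S,
      ENNReal.ofReal (Real.exp (2 * d * ((W T ω - d * T) - (W t ω - d * t)))) ∂P =
      P ((fun ω (s : Iic t) => W s ω) ⁻¹' S) := by
  have hpast : Measurable (fun ω (s : Iic t) => W s ω) := measurable_pi_lambda _ fun s => hm s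
  let g : (ℝ≥0 → ℝ) → ℝ≥0∞ := fun φ =>
    ENNReal.ofReal (Real.exp (2 * d * (φ (T - t) - d * (T - t : ℝ≥0))))
  have hg : Measurable g := by fun_prop
  have hind := (hW.indepFun_shift t).comp hg (measurable_one.indicator hS : Measurable
    (S.indicator (1 : (Iic t → ℝ) → ℝ≥0∞)))
  have h1 := lintegral_mul_eq_lintegral_mul_lintegral_of_indepFun
    (hg.comp (measurable_pi_lambda (fun ω u => W (t + u) ω - W t ω)
      fun u => (hm (t + u)).sub (hm t))) ((measurable_one.indicator hS).comp hpast) hind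
  have h2 : ∫⁻ ω, (g ∘ fun ω u => W (t + u) ω - W t ω) ω ∂P = 1 := by
    have := lintegral_exp_mul_drifted (hW.shift t) (2 * d) d (T - t)
    rw [show ((2 * d) ^ 2 / 2 - 2 * d * d) = 0 by ring] at this
    simpa [g] using this
  rw [h2, one_mul] at h1
  have h3 : ∀ ω, (S.indicator (1 : (Iic t → ℝ) → ℝ≥0∞) ∘ fun ω (s : Iic t) => W s ω) ω =
      ((fun ω (s : Iic t) => W s ω) ⁻¹' S).indicator 1 ω := fun ω => rfl
  simp_rw [h3] at h1
  rw [lintegral_indicator_one (hpast hS)] at h1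
  rw [← h1, ← lintegral_indicator (hpast hS)]
  refine lintegral_congr fun ω => ?_
  simp only [Pi.mul_apply, Function.comp, g, add_tsub_cancel_of_le htT, NNReal.coe_sub htT]
  by_cases hω : ω ∈ (fun ω (s : Iic t) => W s ω) ⁻¹' S
  · simp only [indicator_of_mem hω]
    rw [indicator_of_mem (show (fun s : Iic t => W s ω) ∈ S from hω), Pi.one_apply, mul_one]
    congr 2; ring
  · simp only [indicator_of_notMem hω]
    rw [indicator_of_notMem (show (fun s : Iic t => W s ω) ∉ S from hω), mul_zero]

/-- The event that the drifted path, looked at along the times `t 0, t 1, …`, is at or above the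
level `r` for the first time at `t k`. -/
def firstPassage (W : ℝ≥0 → Ω → ℝ) (d : ℝ) (t : ℕ → ℝ≥0) (r : ℝ) (k : ℕ) : Set Ω :=
  {ω | r ≤ W (t k) ω - d * t k ∧ ∀ j < k, W (t j) ω - d * t j < r}

lemma measurableSet_firstPassage (hm : ∀ t, Measurable (W t)) (t : ℕ → ℝ≥0) (r : ℝ) (k : ℕ) :
    MeasurableSet (firstPassage W d t r k) := by
  have := hm
  unfold firstPassage
  measurability

lemma measure_firstPassage (hW : IsPreBrownianReal W P) (hm : ∀ t, Measurable (W t))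
    {t : ℕ → ℝ≥0} (ht : Monotone t) (r : ℝ) {k : ℕ} {T : ℝ≥0} (hT : t k ≤ T) :
    ∫⁻ ω in firstPassage W d t r k,
      ENNReal.ofReal (Real.exp (2 * d * ((W T ω - d * T) - (W (t k) ω - d * t k)))) ∂P =
      P (firstPassage W d t r k) := by
  let S : Set (Iic (t k) → ℝ) := {φ | r ≤ φ ⟨t k, mem_Iic.2 le_rfl⟩ - d * t k} ∩
    ⋂ j : Fin k, {φ | φ ⟨t j, mem_Iic.2 (ht j.2.le)⟩ - d * t j < r}
  have hS : MeasurableSet S := by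
    refine (measurableSet_le (by fun_prop) (by fun_prop)).inter
      (MeasurableSet.iInter fun j => measurableSet_lt (by fun_prop) (by fun_prop))
  have : firstPassage W d t r k = (fun ω (s : Iic (t k)) => W s ω) ⁻¹' S := by
    ext ω
    simp only [firstPassage, S, mem_ofPred_eq, mem_preimage, mem_inter_iff, mem_iInter]
    exact and_congr_right fun _ => ⟨fun h j => h j j.2, fun h j hj => h ⟨j, hj⟩⟩
  rw [this]
  exact setLIntegral_exp_increment hW hm hT hS

omit [MeasurableSpace Ω] in
lemma iUnion_firstPassage (t : ℕ → ℝ≥0) (r : ℝ) (N : ℕ) :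
    ⋃ k ∈ Finset.range N, firstPassage W d t r k = {ω | ∃ k < N, r ≤ W (t k) ω - d * t k} := by
  classical
  ext ω
  simp only [mem_iUnion, Finset.mem_range, mem_ofPred_eq, exists_prop, firstPassage]
  constructor
  · rintro ⟨k, hk, h, -⟩
    exact ⟨k, hk, h⟩
  · intro h
    have h' : ∃ k, r ≤ W (t k) ω - d * t k := h.imp fun _ hk => hk.2
    obtain ⟨k, hk, hk'⟩ := h
    exact ⟨Nat.find h', (Nat.find_min' h' hk').trans_lt hk, Nat.find_spec h',
      fun j hj => not_le.1 (Nat.find_min h' hj)⟩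

omit [MeasurableSpace Ω] in
lemma pairwise_disjoint_firstPassage (t : ℕ → ℝ≥0) (r : ℝ) :
    Pairwise (Function.onFun Disjoint (firstPassage W d t r)) := by
  have key : ∀ i j, i < j → Disjoint (firstPassage W d t r i) (firstPassage W d t r j) :=
    fun i j hij => disjoint_left.2 fun ω hi hj => absurd (hj.2 i hij) (not_lt.2 hi.1)
  intro i j hij
  rcases hij.lt_or_gt with h | h
  exacts [key i j h, (key j i h).symm]

/-- On a first passage event the path is at least at level `r`, so `exp (-2 d r)` bounds the factor
by which the event is less likely than under the tilted measure. -/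
lemma measure_exists_le_drifted_le (hW : IsPreBrownianReal W P) (hm : ∀ t, Measurable (W t))
    (hd : 0 < d) {t : ℕ → ℝ≥0} (ht : Monotone t) (r : ℝ) (N : ℕ) :
    P {ω | ∃ k < N, r ≤ W (t k) ω - d * t k} ≤ ENNReal.ofReal (Real.exp (-(2 * d * r))) := by
  set T := t N
  have hle : ∀ k ∈ Finset.range N, P (firstPassage W d t r k) ≤
      ENNReal.ofReal (Real.exp (-(2 * d * r))) * ∫⁻ ω in firstPassage W d t r k,
        ENNReal.ofReal (Real.exp (2 * d * (W T ω - d * T))) ∂P := by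
    intro k hk
    rw [← measure_firstPassage hW hm ht r (ht (Finset.mem_range.1 hk).le),
      ← lintegral_const_mul' _ _ ENNReal.ofReal_ne_top]
    refine setLIntegral_mono' (measurableSet_firstPassage hm t r k) fun ω hω => ?_
    rw [← ENNReal.ofReal_mul (Real.exp_pos _).le, ← Real.exp_add]
    refine ENNReal.ofReal_le_ofReal (Real.exp_le_exp.2 ?_)
    have := mul_le_mul_of_nonneg_left hω.1 (by positivity : 0 ≤ 2 * d)
    linarith
  have hdisj : Set.PairwiseDisjoint (↑(Finset.range N)) (firstPassage W d t r) :=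
    fun i _ j _ hij => pairwise_disjoint_firstPassage t r hij
  rw [← iUnion_firstPassage, measure_biUnion_finset hdisj
    fun k _ => measurableSet_firstPassage hm t r k]
  refine (Finset.sum_le_sum hle).trans ?_
  rw [← Finset.mul_sum, ← lintegral_biUnion_finset hdisj
    fun k _ => measurableSet_firstPassage hm t r k]
  refine (mul_le_mul_right (setLIntegral_le_lintegral _ _) _).trans ?_
  rw [lintegral_exp_mul_drifted hW, show ((2 * d) ^ 2 / 2 - 2 * d * d) = 0 by ring]
  simp

/-- The converse comparison, on a set `O` on which the overshoot over `r` is at most `ε`. -/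
lemma setLIntegral_exists_le_drifted_le (hW : IsPreBrownianReal W P) (hm : ∀ t, Measurable (W t))
    (hd : 0 < d) {t : ℕ → ℝ≥0} (ht : Monotone t) {r ε : ℝ} {N : ℕ} {T : ℝ≥0} (hT : t N ≤ T)
    {O : Set Ω} (hO : MeasurableSet O)
    (hOr : ∀ ω ∈ O, ∀ k ≤ N, ω ∈ firstPassage W d t r k → W (t k) ω - d * t k ≤ r + ε) :
    ∫⁻ ω in {ω | ∃ k < N + 1, r ≤ W (t k) ω - d * t k} ∩ O,
      ENNReal.ofReal (Real.exp (2 * d * (W T ω - d * T))) ∂P ≤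
    ENNReal.ofReal (Real.exp (2 * d * (r + ε))) *
      P {ω | ∃ k < N + 1, r ≤ W (t k) ω - d * t k} := by
  have hdisj : Set.PairwiseDisjoint (↑(Finset.range (N + 1))) (firstPassage W d t r) :=
    fun i _ j _ hij => pairwise_disjoint_firstPassage t r hij
  have hms := fun k => measurableSet_firstPassage (d := d) hm t r k
  rw [← iUnion_firstPassage, measure_biUnion_finset hdisj fun k _ => hms k, iUnion₂_inter,
    lintegral_biUnion_finset (hdisj.mono fun k => inter_subset_left)
      fun k _ => (hms k).inter hO, Finset.mul_sum]
  refine Finset.sum_le_sum fun k hk => ?_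
  have hk' : k ≤ N := Nat.lt_succ_iff.1 (Finset.mem_range.1 hk)
  rw [← measure_firstPassage hW hm ht r ((ht hk').trans hT),
    ← lintegral_const_mul' _ _ ENNReal.ofReal_ne_top]
  refine (setLIntegral_mono' ((hms k).inter hO) fun ω hω => ?_).trans
    (lintegral_mono_set inter_subset_left)
  rw [← ENNReal.ofReal_mul (Real.exp_pos _).le, ← Real.exp_add]
  refine ENNReal.ofReal_le_ofReal (Real.exp_le_exp.2 ?_)
  have := mul_le_mul_of_nonneg_left (hOr ω hω.2 k hk' hω.1) (by positivity : 0 ≤ 2 * d)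
  linarith

/-- Under the tilted measure with density `exp (2 d (W T - d T))`, the drifted path is unlikely to
be below a given level at a large time `T`. -/
lemma setLIntegral_exp_drifted_lt_le (hW : IsPreBrownianReal W P) (hm : ∀ t, Measurable (W t))
    (hd : 0 < d) (r : ℝ) (T : ℝ≥0) :
    ∫⁻ ω in {ω | W T ω - d * T < r}, ENNReal.ofReal (Real.exp (2 * d * (W T ω - d * T))) ∂P ≤
      ENNReal.ofReal (Real.exp (d * r - d ^ 2 / 2 * T)) := by
  have hT := hm T
  calc _ ≤ ∫⁻ ω in {ω | W T ω - d * T < r}, ENNReal.ofReal (Real.exp (d * r)) *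
        ENNReal.ofReal (Real.exp (d * (W T ω - d * T))) ∂P := by
        refine setLIntegral_mono' (measurableSet_lt (by fun_prop) (by fun_prop)) fun ω hω => ?_
        rw [← ENNReal.ofReal_mul (Real.exp_pos _).le, ← Real.exp_add]
        refine ENNReal.ofReal_le_ofReal (Real.exp_le_exp.2 ?_)
        have := mul_le_mul_of_nonneg_left (le_of_lt hω) hd.le
        linarith
    _ ≤ _ := setLIntegral_le_lintegral _ _
    _ = _ := by
        rw [lintegral_const_mul' _ _ ENNReal.ofReal_ne_top, lintegral_exp_mul_drifted hW,
          ← ENNReal.ofReal_mul (Real.exp_pos _).le, ← Real.exp_add]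
        congr 2; ring

/-- The bound `E exp (d (W n - d n)) = exp (-d² n / 2)` makes `W n - d n ≥ x` unlikely for large
`n`. -/
lemma ae_exists_drifted_lt (hW : IsPreBrownianReal W P) (hm : ∀ t, Measurable (W t))
    (hd : 0 < d) : ∀ᵐ ω ∂P, ∀ x : ℝ, ∃ u : ℝ≥0, W u ω - d * u < x := by
  have key : ∀ x : ℤ, ∀ᵐ ω ∂P, ∃ u : ℝ≥0, W u ω - d * u < x := by
    intro x
    rw [ae_iff]
    have hb : ∀ n : ℕ, P {ω | ¬ ∃ u : ℝ≥0, W u ω - d * u < x} ≤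
        ENNReal.ofReal (Real.exp (-(d * x) - d ^ 2 / 2 * n)) := by
      intro n
      calc _ ≤ P {ω | 1 ≤ ENNReal.ofReal (Real.exp (-(d * x))) *
              ENNReal.ofReal (Real.exp (d * (W (n : ℝ≥0) ω - d * (n : ℝ≥0))))} := by
            refine measure_mono fun ω hω => ?_
            simp only [mem_ofPred_eq, not_exists, not_lt] at hω ⊢
            rw [← ENNReal.ofReal_mul (Real.exp_pos _).le, ← Real.exp_add, ENNReal.one_le_ofReal,
              Real.one_le_exp_iff]
            have := mul_le_mul_of_nonneg_left (hω n) hd.le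
            linarith
        _ ≤ ∫⁻ ω, ENNReal.ofReal (Real.exp (-(d * x))) *
              ENNReal.ofReal (Real.exp (d * (W (n : ℝ≥0) ω - d * (n : ℝ≥0)))) ∂P := by
            have := hm n
            have h := mul_meas_ge_le_lintegral (μ := P) (f := fun ω =>
              ENNReal.ofReal (Real.exp (-(d * x))) *
              ENNReal.ofReal (Real.exp (d * (W (n : ℝ≥0) ω - d * (n : ℝ≥0))))) (by fun_prop) 1
            rwa [one_mul] at h
        _ = _ := by
            rw [lintegral_const_mul' _ _ ENNReal.ofReal_ne_top, lintegral_exp_mul_drifted hW,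
              ← ENNReal.ofReal_mul (Real.exp_pos _).le, ← Real.exp_add]
            congr 2; push_cast; ring
    have hlim : Tendsto (fun n : ℕ => ENNReal.ofReal (Real.exp (-(d * x) - d ^ 2 / 2 * n))) atTop
        (𝓝 0) := by
      rw [← ENNReal.ofReal_zero]
      refine (ENNReal.continuous_ofReal.tendsto 0).comp (Real.tendsto_exp_atBot.comp ?_)
      simp_rw [sub_eq_add_neg]
      refine tendsto_atBot_add_const_left _ _ (tendsto_neg_atTop_atBot.comp ?_)
      exact tendsto_natCast_atTop_atTop.const_mul_atTop (by positivity)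
    exact le_antisymm (ge_of_tendsto' hlim hb) zero_le
  filter_upwards [ae_all_iff.2 key] with ω hω x
  obtain ⟨u, hu⟩ := hω ⌊x⌋
  exact ⟨u, hu.trans_le (Int.floor_le x)⟩

/-- The supremum of the positive part of the path `w` with drift `-d`, over the dyadic times. -/
noncomputable def pathSup (d : ℝ) (w : ℝ≥0 → ℝ) : ℝ≥0∞ :=
  ⨆ (n : ℕ) (k : ℕ), ENNReal.ofReal (w (k / 2 ^ n) - d * (k / 2 ^ n : ℝ≥0))

lemma measurable_pathSup (d : ℝ) : Measurable (pathSup d) := by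
  unfold pathSup
  fun_prop

/-- The upper bound for the probability that the level `r` is reached. The grids `k / 2 ^ n`,
`k ≤ n * 2 ^ n`, are refined and extended at the same time. -/
lemma measure_dyadic_le_drifted_le (hW : IsPreBrownianReal W P) (hm : ∀ t, Measurable (W t))
    (hd : 0 < d) (r : ℝ) :
    P {ω | ∃ n k : ℕ, r ≤ W (k / 2 ^ n) ω - d * (k / 2 ^ n : ℝ≥0)} ≤
      ENNReal.ofReal (Real.exp (-(2 * d * r))) := by
  let A : ℕ → Set Ω := fun n =>
    {ω | ∃ k < n * 2 ^ n + 1, r ≤ W (k / 2 ^ n) ω - d * (k / 2 ^ n : ℝ≥0)}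
  have hstep : ∀ n k : ℕ, ((2 * k : ℕ) : ℝ≥0) / 2 ^ (n + 1) = k / 2 ^ n := fun n k => by
    push_cast; rw [pow_succ']; exact mul_div_mul_left _ _ two_ne_zero
  have hmono : Monotone A := by
    refine monotone_nat_of_le_succ fun n ω => ?_
    rintro ⟨k, hk, h⟩
    refine ⟨2 * k, ?_, by rwa [hstep]⟩
    have : (n + 1) * 2 ^ (n + 1) = 2 * (n * 2 ^ n) + 2 ^ (n + 1) := by ring
    have := Nat.one_le_two_pow (n := n + 1)
    omega
  have hsub : {ω | ∃ n k : ℕ, r ≤ W (k / 2 ^ n) ω - d * (k / 2 ^ n : ℝ≥0)} ⊆ ⋃ n, A n := by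
    rintro ω ⟨n, k, h⟩
    have hshift : ∀ m : ℕ, ((2 ^ m * k : ℕ) : ℝ≥0) / 2 ^ (n + m) = k / 2 ^ n := fun m => by
      push_cast; rw [pow_add, mul_comm (2 ^ n : ℝ≥0)]
      exact mul_div_mul_left _ _ (by positivity)
    refine mem_iUnion.2 ⟨n + k, 2 ^ k * k, ?_, by rwa [hshift]⟩
    have : 2 ^ k ≤ 2 ^ (n + k) := Nat.pow_le_pow_right (by norm_num) (by omega)
    nlinarith [Nat.zero_le n, Nat.zero_le (2 ^ (n + k))]
  refine (measure_mono hsub).trans ?_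
  rw [hmono.measure_iUnion]
  refine iSup_le fun n => ?_
  refine measure_exists_le_drifted_le hW hm hd (t := fun k => k / 2 ^ n) (fun i j hij => ?_) r _
  dsimp only
  gcongr

lemma exists_dyadic_increment_le {y : ℝ≥0 → ℝ} (hy : Continuous y) {ε : ℝ} (hε : 0 < ε) (T : ℕ) :
    ∀ᶠ n : ℕ in atTop, ∀ k < T * 2 ^ n, y ((k + 1 : ℕ) / 2 ^ n) ≤ y (k / 2 ^ n) + ε := by
  have hu := (isCompact_Icc (a := (0 : ℝ≥0)) (b := T)).uniformContinuousOn_of_continuous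
    hy.continuousOn
  obtain ⟨δ, hδ, h⟩ := Metric.uniformContinuousOn_iff.1 hu ε hε
  have hlim : Tendsto (fun n : ℕ => ((1 : ℝ) / 2) ^ n) atTop (𝓝 0) :=
    tendsto_pow_atTop_nhds_zero_of_lt_one (by norm_num) (by norm_num)
  filter_upwards [hlim.eventually (gt_mem_nhds hδ)] with n hn k hk
  have hpos : (0 : ℝ≥0) < 2 ^ n := by positivity
  have hkT : ∀ j : ℕ, j ≤ T * 2 ^ n → (j / 2 ^ n : ℝ≥0) ∈ Icc (0 : ℝ≥0) T := fun j hj =>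
    ⟨zero_le, (div_le_iff₀ hpos).2 (by exact_mod_cast hj)⟩
  have := h _ (hkT (k + 1) hk) _ (hkT k hk.le) (by
    rw [NNReal.dist_eq]
    push_cast
    rw [← sub_div, add_sub_cancel_left, abs_of_pos (by positivity)]
    simpa using hn)
  rw [Real.dist_eq] at this
  linarith [le_abs_self (y ((k + 1 : ℕ) / 2 ^ n) - y (k / 2 ^ n))]

/-- The lower bound for the probability that the level `r` is reached: at a fixed horizon `T` the
grid is refined first, which makes the overshoot small, and `T` tends to infinity afterwards. -/
lemma le_measure_dyadic_le_drifted (hW : IsBrownianReal W P) (hm : ∀ t, Measurable (W t))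
    (hd : 0 < d) {r : ℝ} (hr : 0 < r) :
    ENNReal.ofReal (Real.exp (-(2 * d * r))) ≤
      P {ω | ∃ n k : ℕ, r ≤ W (k / 2 ^ n) ω - d * (k / 2 ^ n : ℝ≥0)} := by
  have hP := hW.toIsPreBrownianReal
  set H := P {ω | ∃ n k : ℕ, r ≤ W (k / 2 ^ n) ω - d * (k / 2 ^ n : ℝ≥0)} with hH
  have : IsProbabilityMeasure P := hP.isGaussianProcess.isProbabilityMeasure
  have hHtop : H ≠ ∞ := measure_ne_top _ _
  -- The total mass of the tilted measure, split according to whether the level is reached.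
  have main : ∀ ε > 0, ∀ T : ℕ, 1 ≤ ENNReal.ofReal (Real.exp (2 * d * (r + ε))) * H +
      ENNReal.ofReal (Real.exp (d * r - d ^ 2 / 2 * T)) := by
    intro ε hε T
    let Z : Ω → ℝ≥0∞ := fun ω => ENNReal.ofReal (Real.exp (2 * d * (W T ω - d * (T : ℝ≥0))))
    have hZm : Measurable Z := by have := hm T; fun_prop
    have hZ : ∫⁻ ω, Z ω ∂P = 1 := by
      have := lintegral_exp_mul_drifted hP (2 * d) d T
      rw [show ((2 * d) ^ 2 / 2 - 2 * d * d) = 0 by ring] at this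
      simpa [Z] using this
    -- On `O n` no increment over the grid of mesh `2⁻ⁿ` exceeds `ε`, so the overshoot is at most `ε`.
    let O : ℕ → Set Ω := fun n => {ω | W 0 ω - d * (0 : ℝ≥0) < r} ∩
      ⋂ k : Fin (T * 2 ^ n), {ω | W ((k.1 + 1 : ℕ) / 2 ^ n) ω - d * ((k.1 + 1 : ℕ) / 2 ^ n : ℝ≥0) ≤
        W (k.1 / 2 ^ n) ω - d * (k.1 / 2 ^ n : ℝ≥0) + ε}
    have hO : ∀ n, MeasurableSet (O n) := by
      have := hm
      intro n
      exact (measurableSet_lt (by fun_prop) (by fun_prop)).inter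
        (MeasurableSet.iInter fun k => measurableSet_le (by fun_prop) (by fun_prop))
    have hbound : ∀ n, 1 ≤ ENNReal.ofReal (Real.exp (2 * d * (r + ε))) * H +
        ENNReal.ofReal (Real.exp (d * r - d ^ 2 / 2 * T)) + ∫⁻ ω in (O n)ᶜ, Z ω ∂P := by
      intro n
      let t : ℕ → ℝ≥0 := fun k => k / 2 ^ n
      have ht : Monotone t := fun i j hij => by dsimp only [t]; gcongr
      have htT : t (T * 2 ^ n) = T := by simp [t]
      let A : Set Ω := {ω | ∃ k < T * 2 ^ n + 1, r ≤ W (t k) ω - d * t k}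
      have h1 := setLIntegral_exists_le_drifted_le hP hm hd ht (r := r) (ε := ε)
        (N := T * 2 ^ n) htT.le (hO n) (by
          intro ω hω k hk hkω
          rcases k with _ | k
          · refine absurd hkω.1 (not_le.2 ?_)
            simpa [t] using hω.1
          · have h2 := mem_iInter.1 hω.2 ⟨k, by omega⟩
            have h3 := hkω.2 k (Nat.lt_succ_self k)
            simp only [mem_ofPred_eq] at h2
            dsimp only [t] at h3 ⊢
            linarith)
      have h2 := setLIntegral_exp_drifted_lt_le hP hm hd r T
      have hcov : (univ : Set Ω) ⊆ ((A ∩ O n) ∪ {ω | W T ω - d * (T : ℝ≥0) < r}) ∪ (O n)ᶜ := by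
        intro ω _
        by_cases hω : ω ∈ O n
        · left
          by_cases hT : W T ω - d * (T : ℝ≥0) < r
          · exact Or.inr hT
          · exact Or.inl ⟨⟨T * 2 ^ n, Nat.lt_succ_self _, by rw [htT]; exact not_lt.1 hT⟩, hω⟩
        · exact Or.inr hω
      have hAH : P A ≤ H := measure_mono fun ω ⟨k, _, hk⟩ => ⟨n, k, hk⟩
      calc 1 = ∫⁻ ω in univ, Z ω ∂P := by rw [setLIntegral_univ, hZ]
        _ ≤ _ := lintegral_mono_set hcov
        _ ≤ _ := lintegral_union_le _ _ _
        _ ≤ _ := by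
          gcongr
          refine (lintegral_union_le _ _ _).trans (add_le_add (h1.trans ?_) ?_)
          · gcongr
          · simpa [Z] using h2
    have hlim : Tendsto (fun n => ∫⁻ ω in (O n)ᶜ, Z ω ∂P) atTop (𝓝 0) := by
      simp_rw [← lintegral_indicator (hO _).compl]
      rw [← lintegral_zero (μ := P)]
      refine tendsto_lintegral_of_dominated_convergence Z
        (fun n => hZm.indicator (hO n).compl) (fun n => ae_of_all _ fun ω => indicator_le_self _ _ _)
        (by rw [hZ]; exact ENNReal.one_ne_top) ?_
      filter_upwards [hW.cont, hP.eval_zero_ae_eq_zero] with ω hc h0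
      refine tendsto_const_nhds.congr' ?_
      have hc' : Continuous fun u : ℝ≥0 => W u ω - d * u := by fun_prop
      filter_upwards [exists_dyadic_increment_le hc' hε T] with n hn
      rw [indicator_of_notMem]
      exact fun h => h ⟨by simpa [h0] using hr, mem_iInter.2 fun k => hn k k.2⟩
    have := ge_of_tendsto' (tendsto_const_nhds.add hlim) hbound
    simpa using this
  have main' : ∀ ε > 0, 1 ≤ ENNReal.ofReal (Real.exp (2 * d * (r + ε))) * H := by
    intro ε hε
    have hlim : Tendsto (fun T : ℕ => ENNReal.ofReal (Real.exp (d * r - d ^ 2 / 2 * T))) atTop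
        (𝓝 0) := by
      rw [← ENNReal.ofReal_zero]
      refine (ENNReal.continuous_ofReal.tendsto 0).comp (Real.tendsto_exp_atBot.comp ?_)
      simp_rw [sub_eq_add_neg]
      refine tendsto_atBot_add_const_left _ _ (tendsto_neg_atTop_atBot.comp ?_)
      exact tendsto_natCast_atTop_atTop.const_mul_atTop (by positivity)
    have := ge_of_tendsto' (tendsto_const_nhds.add hlim) (main ε hε)
    simpa using this
  have hreal : ∀ ε > 0, Real.exp (-(2 * d * (r + ε))) ≤ H.toReal := by
    intro ε hε
    have := ENNReal.toReal_mono (by finiteness) (main' ε hε)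
    rw [ENNReal.toReal_mul, ENNReal.toReal_ofReal (Real.exp_pos _).le, ENNReal.toReal_one] at this
    rw [Real.exp_neg, inv_le_iff_one_le_mul₀' (Real.exp_pos _)]
    exact this
  rw [ENNReal.ofReal_le_iff_le_toReal hHtop]
  have hc : Tendsto (fun ε : ℝ => Real.exp (-(2 * d * (r + ε)))) (𝓝[>] 0)
      (𝓝 (Real.exp (-(2 * d * (r + 0))))) :=
    (Continuous.tendsto (by fun_prop) 0).mono_left nhdsWithin_le_nhds
  rw [add_zero] at hc
  exact le_of_tendsto hc (eventually_mem_nhdsWithin.mono fun ε hε => hreal ε hε)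

lemma measure_lt_pathSup (hW : IsBrownianReal W P) (hm : ∀ t, Measurable (W t))
    (hd : 0 < d) {r : ℝ} (hr : 0 ≤ r) :
    P {ω | ENNReal.ofReal r < pathSup d (fun t => W t ω)} =
      ENNReal.ofReal (Real.exp (-(2 * d * r))) := by
  have heq : {ω | ENNReal.ofReal r < pathSup d (fun t => W t ω)} =
      {ω | ∃ n k : ℕ, r < W (k / 2 ^ n) ω - d * (k / 2 ^ n : ℝ≥0)} := by
    ext ω
    simp only [pathSup, lt_iSup_iff, mem_ofPred_eq, ENNReal.ofReal_lt_ofReal_iff_of_nonneg hr]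
  rw [heq]
  refine le_antisymm ((measure_mono ?_).trans
    (measure_dyadic_le_drifted_le hW.toIsPreBrownianReal hm hd r)) ?_
  · rintro ω ⟨n, k, h⟩
    exact ⟨n, k, h.le⟩
  have hc : Tendsto (fun s : ℝ => ENNReal.ofReal (Real.exp (-(2 * d * s)))) (𝓝[>] r)
      (𝓝 (ENNReal.ofReal (Real.exp (-(2 * d * r))))) :=
    (ENNReal.continuous_ofReal.comp (by fun_prop : Continuous fun s : ℝ =>
      Real.exp (-(2 * d * s)))).continuousWithinAt
  refine le_of_tendsto hc (eventually_mem_nhdsWithin.mono fun s hs => ?_)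
  exact (le_measure_dyadic_le_drifted hW hm hd (hr.trans_lt hs)).trans
    (measure_mono fun ω ⟨n, k, h⟩ => ⟨n, k, lt_of_lt_of_le hs h⟩)

/-- The supremum of a Brownian motion with drift `-d` is exponentially distributed with
parameter `2 d`. -/
lemma measure_pathSup_le (hW : IsBrownianReal W P) (hm : ∀ t, Measurable (W t))
    (hd : 0 < d) {r : ℝ} (hr : 0 ≤ r) :
    P {ω | pathSup d (fun t => W t ω) ≤ ENNReal.ofReal r} =
      ENNReal.ofReal (1 - Real.exp (-(2 * d * r))) := by
  have : IsProbabilityMeasure P := hW.isGaussianProcess.isProbabilityMeasure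
  have hmeas : MeasurableSet {ω | ENNReal.ofReal r < pathSup d (fun t => W t ω)} :=
    measurableSet_lt measurable_const
      ((measurable_pathSup d).comp (measurable_pi_lambda _ fun t => hm t))
  have : {ω | pathSup d (fun t => W t ω) ≤ ENNReal.ofReal r} =
      {ω | ENNReal.ofReal r < pathSup d (fun t => W t ω)}ᶜ := by
    ext ω; simp
  rw [this, prob_compl_eq_one_sub hmeas, measure_lt_pathSup hW hm hd hr,
    ENNReal.ofReal_sub _ (Real.exp_pos _).le, ENNReal.ofReal_one]

end Brownian

/-! ### The spread of activity for given paths -/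

section Dynamics

variable {x : ℕ → ℝ} {Y : ℕ → ℝ≥0 → ℝ}

/-- A frog whose displacement is continuous and unbounded below hits the origin as soon as it is
woken at all. -/
lemma hitsOrigin_iff {j : ℕ} (hx : 0 ≤ x j) (hc : Continuous (Y j)) (h0 : Y j 0 = 0)
    (hu : ∃ u, Y j u < -x j) : HitsOrigin x Y j ↔ activationTime x Y j ≠ ∞ := by
  constructor
  · rintro ⟨t, ht, -⟩
    exact ne_top_of_le_ne_top ENNReal.coe_ne_top ht
  · intro ht
    obtain ⟨u, hu⟩ := hu
    obtain ⟨v, hv⟩ := mem_range_of_exists_le_of_exists_ge hc (c := -x j) ⟨u, hu.le⟩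
      ⟨0, by rw [h0]; linarith⟩
    have hle : activationTime x Y j ≤ ((activationTime x Y j).toNNReal + v : ℝ≥0) := by
      rw [ENNReal.coe_add, ENNReal.coe_toNNReal ht]
      exact le_self_add
    refine ⟨(activationTime x Y j).toNNReal + v, hle, ?_⟩
    rw [position, if_pos hle, add_tsub_cancel_left, hv, add_neg_cancel]

/-- If no frog that starts to the left of `a` ever reaches `a`, then no frog that starts at `a` or
to the right of it is woken. -/
lemma activationTime_eq_top {a : ℝ} (hx0 : x 0 < a)
    (h : ∀ i, x i < a → ∀ u, x i + Y i u < a) {j : ℕ} (hj : a ≤ x j) :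
    activationTime x Y j = ∞ := by
  have key : ∀ n j, a ≤ x j → chainTime x Y n j = ∞ := by
    intro n
    induction n with
    | zero =>
      intro j hj
      rw [chainTime, if_neg]
      rintro rfl
      exact absurd hx0 (not_lt.2 hj)
    | succ n ih =>
      intro j hj
      rw [chainTime, iInf_eq_top]
      intro i
      rcases le_or_gt a (x i) with hi | hi
      · rw [ih i hi, top_add]
      · rw [passageTime]
        simp only [ENNReal.add_eq_top]
        right
        simp only [iInf_eq_top]
        intro u hu
        exact absurd (h i hi u) (not_lt.2 (hu ▸ hj))
  exact iInf_eq_top.2 fun n => key n j hj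

/-- If the starting point of every frog but the first is reached by a frog with a smaller index,
then all frogs are woken. -/
lemma activationTime_ne_top (hc : ∀ i, Continuous (Y i)) (h0 : ∀ i, Y i 0 = 0)
    (hmono : ∀ i j, i ≤ j → x i ≤ x j)
    (h : ∀ j, j ≠ 0 → ∃ i < j, ∃ u, x j ≤ x i + Y i u) (j : ℕ) :
    activationTime x Y j ≠ ∞ := by
  induction j using Nat.strong_induction_on with
  | _ j ih =>
    rcases eq_or_ne j 0 with rfl | hj
    · refine ne_top_of_le_ne_top ENNReal.zero_ne_top (iInf_le_of_le 0 ?_)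
      simp [chainTime]
    · obtain ⟨i, hij, u, hu⟩ := h j hj
      obtain ⟨v, hv⟩ := mem_range_of_exists_le_of_exists_ge
        (continuous_const.add (hc i) : Continuous fun u => x i + Y i u) (c := x j)
        ⟨0, by simpa [h0] using hmono i j hij.le⟩ ⟨u, hu⟩
      obtain ⟨n, hn⟩ : ∃ n, chainTime x Y n i ≠ ∞ := by
        by_contra! hcon
        exact ih i hij (iInf_eq_top.2 hcon)
      have hp : passageTime x Y i j ≤ v := iInf₂_le v hv
      refine ne_top_of_le_ne_top ?_ ((iInf_le _ (n + 1)).trans (iInf_le _ i))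
      exact ENNReal.add_ne_top.2 ⟨hn, ne_top_of_le_ne_top ENNReal.coe_ne_top hp⟩

lemma le_of_pathSup_le {d : ℝ} {w : ℝ≥0 → ℝ} (hw : Continuous w) {r : ℝ} (hr : 0 ≤ r)
    (h : pathSup d w ≤ ENNReal.ofReal r) (u : ℝ≥0) : w u - d * u ≤ r := by
  have hdy : ∀ n k : ℕ, w (k / 2 ^ n) - d * (k / 2 ^ n : ℝ≥0) ≤ r := fun n k =>
    (ENNReal.ofReal_le_ofReal_iff hr).1 ((iSup₂_le_iff.1 h) n k)
  have hlim : Tendsto (fun n : ℕ => ((⌊(u : ℝ) * 2 ^ n⌋₊ : ℝ≥0) / 2 ^ n : ℝ≥0)) atTop (𝓝 u) := by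
    rw [← NNReal.tendsto_coe]
    have := (tendsto_nat_floor_mul_div_atTop (R := ℝ) u.2).comp
      (tendsto_pow_atTop_atTop_of_one_lt (one_lt_two : (1 : ℝ) < 2))
    simpa [Function.comp_def] using this
  have hcont : Continuous fun v : ℝ≥0 => w v - d * v := by fun_prop
  exact le_of_tendsto' ((hcont.tendsto u).comp hlim) fun n => hdy n _

lemma exists_lt_of_lt_pathSup {d : ℝ} {w : ℝ≥0 → ℝ} {r : ℝ} (hr : 0 ≤ r)
    (h : ENNReal.ofReal r < pathSup d w) : ∃ u : ℝ≥0, r < w u - d * u := by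
  simp only [pathSup, lt_iSup_iff, ENNReal.ofReal_lt_ofReal_iff_of_nonneg hr] at h
  obtain ⟨n, k, h⟩ := h
  exact ⟨_, h⟩

end Dynamics

/-! ### Groups of frogs and their largest displacements -/

section MarkedPoints

/-- The frogs with label `o`: the label `none` stands for frog `0` alone, the label `some l` for
the sleeping frogs that start in `I l`. -/
def frogGroup (I : ℕ → Set ℝ) (x : ℕ → ℝ) : Option ℕ → Set ℕ
  | none => {0}
  | some l => Nat.succ '' {i | x i ∈ I l}

/-- The largest of the marks `m i` of the frogs `i` with label `o` (`0` if there are none). -/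
noncomputable def reach (I : ℕ → Set ℝ) (x : ℕ → ℝ) (m : ℕ → ℝ≥0∞) (o : Option ℕ) : ℝ≥0∞ :=
  ⨆ i ∈ frogGroup I x o, m i

variable {I : ℕ → Set ℝ}

lemma reach_none (x : ℕ → ℝ) (m : ℕ → ℝ≥0∞) : reach I x m none = m 0 := by
  simp [reach, frogGroup]

lemma reach_some_le_iff {x : ℕ → ℝ} {m : ℕ → ℝ≥0∞} {l : ℕ} {c : ℝ≥0∞} :
    reach I x m (some l) ≤ c ↔ ∀ i, x i ∈ I l → m (i + 1) ≤ c := by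
  simp [reach, frogGroup]

lemma lt_reach_some_iff {x : ℕ → ℝ} {m : ℕ → ℝ≥0∞} {l : ℕ} {c : ℝ≥0∞} :
    c < reach I x m (some l) ↔ ∃ i, x i ∈ I l ∧ c < m (i + 1) := by
  rw [← not_le, reach_some_le_iff]
  push Not
  rfl

lemma measurableSet_mem_frogGroup (hI : ∀ l, MeasurableSet (I l)) (o : Option ℕ) (i : ℕ) :
    MeasurableSet {x : ℕ → ℝ | i ∈ frogGroup I x o} := by
  rcases o with _ | l
  · exact MeasurableSet.const _
  · have : {x : ℕ → ℝ | i ∈ frogGroup I x (some l)} =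
        ⋃ j : ℕ, {x : ℕ → ℝ | x j ∈ I l ∧ j.succ = i} := by
      ext x; simp [frogGroup]
    rw [this]
    exact MeasurableSet.iUnion fun j =>
      ((hI l).preimage (measurable_pi_apply j)).inter (MeasurableSet.const _)

lemma pairwise_disjoint_frogGroup (hI : Pairwise (Function.onFun Disjoint I)) (x : ℕ → ℝ) :
    Pairwise (Function.onFun Disjoint (frogGroup I x)) := by
  have hnone : ∀ l, Disjoint (frogGroup I x none) (frogGroup I x (some l)) := fun l => by
    rw [frogGroup, frogGroup, disjoint_singleton_left]
    rintro ⟨i, -, hi⟩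
    exact Nat.succ_ne_zero i hi
  rintro (_ | l) (_ | l') h
  · exact absurd rfl h
  · exact hnone l'
  · exact (hnone l).symm
  · refine (disjoint_image_iff Nat.succ_injective).2 (disjoint_left.2 fun i hi hi' => ?_)
    exact disjoint_left.1 (hI fun h' => h (congrArg some h')) hi hi'

variable {Ω : Type*} [MeasurableSpace Ω] {P : Measure Ω} {M : ℕ → Ω → ℝ≥0∞} {G : ℝ≥0∞ → ℝ≥0∞}

/-- For fixed disjoint finite groups `J o` of indices, all marks in `J o` are at most `r o` with
probability `∏ G (r o) ^ #(J o)`, where `G` is the common distribution function of the marks. -/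
lemma measure_forall_le_eq_prod {ι : Type*} (hM : iIndepFun M P)
    (hG : ∀ i c, P {ω | M i ω ≤ c} = G c) {J : ι → Set ℕ}
    (hJ : Pairwise (Function.onFun Disjoint J)) (s : Finset ι) (hfin : ∀ o ∈ s, (J o).Finite)
    (r : ι → ℝ≥0∞) :
    P {ω | ∀ o ∈ s, ∀ i ∈ J o, M i ω ≤ r o} = ∏ o ∈ s, G (r o) ^ (J o).ncard := by
  classical
  let T : ι → Finset ℕ := fun o => if h : (J o).Finite then h.toFinset else ∅
  have hT : ∀ o ∈ s, ∀ i, i ∈ T o ↔ i ∈ J o := fun o ho i => by simp [T, hfin o ho]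
  have hTcard : ∀ o ∈ s, (T o).card = (J o).ncard := fun o ho => by
    rw [Set.ncard_eq_toFinset_card _ (hfin o ho)]
    simp [T, hfin o ho]
  let ρ : ℕ → ℝ≥0∞ := fun i => ⨅ o ∈ s, ⨅ (_ : i ∈ J o), r o
  have hρ : ∀ o ∈ s, ∀ i ∈ J o, ρ i = r o := by
    intro o ho i hi
    refine le_antisymm (iInf₂_le_of_le o ho (iInf_le _ hi)) ?_
    refine le_iInf₂ fun o' ho' => le_iInf fun hi' => ?_
    have : o = o' := by
      by_contra hne
      exact disjoint_left.1 (hJ hne) hi hi'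
    rw [this]
  have hev : {ω | ∀ o ∈ s, ∀ i ∈ J o, M i ω ≤ r o} = ⋂ i ∈ s.biUnion T, M i ⁻¹' Iic (ρ i) := by
    ext ω
    simp only [mem_ofPred_eq, mem_iInter, Finset.mem_biUnion, mem_preimage, mem_Iic]
    constructor
    · rintro h i ⟨o, ho, hi⟩
      rw [hT o ho] at hi
      rw [hρ o ho i hi]
      exact h o ho i hi
    · intro h o ho i hi
      rw [← hρ o ho i hi]
      exact h i ⟨o, ho, (hT o ho i).2 hi⟩
  rw [hev, hM.measure_inter_preimage_eq_mul _ fun _ _ => measurableSet_Iic,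
    Finset.prod_biUnion]
  · refine Finset.prod_congr rfl fun o ho => ?_
    rw [← hTcard o ho, ← Finset.prod_const]
    refine Finset.prod_congr rfl fun i hi => ?_
    rw [← hρ o ho i ((hT o ho i).1 hi)]
    exact hG i _
  · intro o ho o' ho' hne
    refine Finset.disjoint_left.2 fun i hi hi' => ?_
    exact disjoint_left.1 (hJ hne) ((hT o ho i).1 hi) ((hT o' ho' i).1 hi')

lemma measure_mem_prod_eq_lintegral {α β : Type*} [MeasurableSpace α] [MeasurableSpace β]
    [IsProbabilityMeasure P] {A : Ω → α} {B : Ω → β} (hA : Measurable A) (hB : Measurable B)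
    (hAB : IndepFun A B P) {S : Set (α × β)} (hS : MeasurableSet S) :
    P {ω | (A ω, B ω) ∈ S} = ∫⁻ ω, P {ω' | (A ω, B ω') ∈ S} ∂P := by
  have h := (indepFun_iff_map_prod_eq_prod_map_map hA.aemeasurable hB.aemeasurable).1 hAB
  have := Measure.isProbabilityMeasure_map (μ := P) hB.aemeasurable
  calc P {ω | (A ω, B ω) ∈ S} = P.map (fun ω => (A ω, B ω)) S :=
        (Measure.map_apply (hA.prodMk hB) hS).symm
    _ = ∫⁻ a, P.map B (Prod.mk a ⁻¹' S) ∂(P.map A) := by rw [h, Measure.prod_apply hS]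
    _ = ∫⁻ ω, P.map B (Prod.mk (A ω) ⁻¹' S) ∂P :=
        lintegral_map (measurable_measure_prodMk_left hS) hA
    _ = _ := by
        refine lintegral_congr fun ω => ?_
        rw [Measure.map_apply hB (measurable_prodMk_left hS)]
        rfl

lemma lintegral_pow_poissonMeasure {c : ℝ≥0} {q : ℝ} (hq : 0 ≤ q) :
    ∫⁻ n : ℕ, ENNReal.ofReal q ^ n ∂(poissonMeasure c) =
      ENNReal.ofReal (Real.exp (-(c * (1 - q)))) := by
  rw [poissonMeasure, lintegral_sum_measure]
  simp_rw [lintegral_smul_measure, lintegral_dirac, smul_eq_mul, ← ENNReal.ofReal_pow hq]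
  have hs : HasSum (fun n : ℕ => Real.exp (-c) * c ^ n / n.factorial * q ^ n)
      (Real.exp (-(c * (1 - q)))) := by
    have h := (NormedSpace.expSeries_div_hasSum_exp (c * q : ℝ)).mul_left (Real.exp (-c))
    rw [← Real.exp_eq_exp_ℝ, ← Real.exp_add] at h
    have h1 : (fun n : ℕ => Real.exp (-c) * c ^ n / n.factorial * q ^ n) =
        fun n : ℕ => Real.exp (-c) * ((c * q) ^ n / n.factorial) := by
      funext n; rw [mul_pow]; ring
    rw [h1, show -(c * (1 - q)) = -(c : ℝ) + c * q by ring]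
    exact h
  rw [← hs.tsum_eq, ENNReal.ofReal_tsum_of_nonneg (fun n => by positivity) hs.summable]
  exact tsum_congr fun n => (ENNReal.ofReal_mul (by positivity)).symm

lemma lintegral_prod_pow_of_poisson {N : ℕ → Ω → ℕ∞} {c : ℝ≥0}
    (hN : ∀ l, HasLaw (N l) ((poissonMeasure c).map (Nat.cast : ℕ → ℕ∞)) P)
    (hind : iIndepFun N P) (s : Finset ℕ) {q : ℕ → ℝ} (hq : ∀ l, 0 ≤ q l) :
    ∫⁻ ω, ∏ l ∈ s, ENNReal.ofReal (q l) ^ (N l ω).toNat ∂P =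
      ∏ l ∈ s, ENNReal.ofReal (Real.exp (-(c * (1 - q l)))) := by
  let N' : ℕ → Ω → ℕ∞ := fun l => (hN l).aemeasurable.mk (N l)
  have hN' : ∀ l, N l =ᵐ[P] N' l := fun l => (hN l).aemeasurable.ae_eq_mk
  have hm : ∀ l, Measurable (N' l) := fun l => (hN l).aemeasurable.measurable_mk
  let g : ℕ → ℕ∞ → ℝ≥0∞ := fun l n => ENNReal.ofReal (q l) ^ n.toNat
  have hg : ∀ l, Measurable (g l) := fun l => Measurable.of_discrete
  have h1 := lintegral_prod_eq_prod_lintegral_of_indepFun s (fun l ω => g l (N' l ω))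
    ((hind.congr hN').comp g hg) fun l => (hg l).comp (hm l)
  have h2 : ∫⁻ ω, ∏ l ∈ s, ENNReal.ofReal (q l) ^ (N l ω).toNat ∂P =
      ∫⁻ ω, ∏ l ∈ s, g l (N' l ω) ∂P := by
    refine lintegral_congr_ae ?_
    filter_upwards [ae_all_iff.2 hN'] with ω hω
    exact Finset.prod_congr rfl fun l _ => by rw [hω l]
  rw [h2, h1]
  refine Finset.prod_congr rfl fun l _ => ?_
  rw [((hN l).congr (hN' l).symm).lintegral_comp (hg l).aemeasurable,
    lintegral_map (hg l) (by fun_prop)]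
  simpa [g] using lintegral_pow_poissonMeasure (c := c) (hq l)

end MarkedPoints

section ReachLaw

variable {Ω : Type*} [MeasurableSpace Ω] {P : Measure Ω} [IsProbabilityMeasure P]
  {I : ℕ → Set ℝ} {X : ℕ → Ω → ℝ} {M : ℕ → Ω → ℝ≥0∞} {G : ℝ≥0∞ → ℝ}

lemma measurable_reach (hI : ∀ l, MeasurableSet (I l)) (hX : ∀ n, Measurable (X n))
    (hM : ∀ i, Measurable (M i)) (o : Option ℕ) :
    Measurable fun ω => reach I (fun n => X n ω) (fun i => M i ω) o := by
  refine Measurable.iSup fun i => ?_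
  have hset : MeasurableSet {ω | i ∈ frogGroup I (fun n => X n ω) o} :=
    (measurableSet_mem_frogGroup hI o i).preimage (measurable_pi_lambda _ hX)
  have : (fun ω => ⨆ (_ : i ∈ frogGroup I (fun n => X n ω) o), M i ω) =
      {ω | i ∈ frogGroup I (fun n => X n ω) o}.indicator (M i) := by
    ext ω
    by_cases h : i ∈ frogGroup I (fun n => X n ω) o
    · rw [indicator_of_mem (show ω ∈ {ω | i ∈ frogGroup I (fun n => X n ω) o} from h)]
      simp [h]
    · rw [indicator_of_notMem (show ω ∉ {ω | i ∈ frogGroup I (fun n => X n ω) o} from h)]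
      simp [h]
  rw [this]
  exact (hM i).indicator hset

variable (hI : ∀ l, MeasurableSet (I l)) (hIdisj : Pairwise (Function.onFun Disjoint I))
  (hX : ∀ n, Measurable (X n)) (hMm : ∀ i, Measurable (M i))
  (hXM : IndepFun (fun ω n => X n ω) (fun ω i => M i ω) P) (hM : iIndepFun M P)
  (hG0 : ∀ c, 0 ≤ G c) (hG : ∀ i c, P {ω | M i ω ≤ c} = ENNReal.ofReal (G c)) {c : ℝ≥0}
  (hN : ∀ l, HasLaw (fun ω => pointCount (fun n => X n ω) (I l))
    ((poissonMeasure c).map (Nat.cast : ℕ → ℕ∞)) P)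
  (hNind : iIndepFun (fun l ω => pointCount (fun n => X n ω) (I l)) P)
include hI hIdisj hX hMm hXM hM hG0 hG hN hNind

/-- Given the starting points, the marks are independent of each other. Averaging over the Poisson
numbers of points turns each factor into a Poisson generating function. -/
lemma measure_forall_reach_le (s : Finset ℕ) (r : Option ℕ → ℝ≥0∞) :
    P {ω | ∀ o ∈ s.insertNone, reach I (fun n => X n ω) (fun i => M i ω) o ≤ r o} =
      ENNReal.ofReal (G (r none)) *
        ∏ l ∈ s, ENNReal.ofReal (Real.exp (-(c * (1 - G (r (some l)))))) := by
  let S : Set ((ℕ → ℝ) × (ℕ → ℝ≥0∞)) :=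
    {p | ∀ o ∈ s.insertNone, ∀ i ∈ frogGroup I p.1 o, p.2 i ≤ r o}
  have hS : MeasurableSet S := by
    have : S = ⋂ o ∈ s.insertNone, ⋂ i : ℕ,
        {p : (ℕ → ℝ) × (ℕ → ℝ≥0∞) | i ∈ frogGroup I p.1 o}ᶜ ∪ {p | p.2 i ≤ r o} := by
      ext p
      simp only [S, mem_ofPred_eq, mem_iInter, mem_union, mem_compl_iff, ← imp_iff_not_or]
    rw [this]
    refine Finset.measurableSet_biInter _ fun o _ => MeasurableSet.iInter fun i => ?_
    exact ((measurableSet_mem_frogGroup hI o i).preimage measurable_fst).compl.union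
      (measurableSet_le ((measurable_pi_apply i).comp measurable_snd) measurable_const)
  have h1 := measure_mem_prod_eq_lintegral (measurable_pi_lambda _ hX)
    (measurable_pi_lambda _ hMm) hXM hS
  have hfin : ∀ᵐ ω ∂P, ∀ l, {n | X n ω ∈ I l}.Finite := by
    refine ae_all_iff.2 fun l => ?_
    have : ∀ᵐ n ∂((poissonMeasure c).map (Nat.cast : ℕ → ℕ∞)), n ≠ ⊤ := by
      rw [ae_map_iff (by fun_prop) (MeasurableSet.of_discrete)]
      exact ae_of_all _ fun n => ENat.natCast_ne_top n
    filter_upwards [((hN l).ae_iff (p := fun n => n ≠ ⊤) Measurable.of_discrete).2 this] with ω hω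
    exact Set.encard_ne_top_iff.1 hω
  have h2 : ∫⁻ ω, P {ω' | ((fun n => X n ω), (fun i => M i ω')) ∈ S} ∂P =
      ∫⁻ ω, ENNReal.ofReal (G (r none)) * ∏ l ∈ s, ENNReal.ofReal (G (r (some l))) ^
        (pointCount (fun n => X n ω) (I l)).toNat ∂P := by
    refine lintegral_congr_ae ?_
    filter_upwards [hfin] with ω hω
    have h3 := measure_forall_le_eq_prod hM hG
      (pairwise_disjoint_frogGroup hIdisj fun n => X n ω) s.insertNone (by
        rintro (_ | l) -
        · exact Set.finite_singleton 0
        · exact (hω l).image _) r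
    refine h3.trans ?_
    rw [Finset.prod_insertNone]
    simp only [frogGroup, Set.ncard_singleton, pow_one,
      Set.ncard_image_of_injective _ Nat.succ_injective]
    rfl
  have h4 : {ω | ∀ o ∈ s.insertNone, reach I (fun n => X n ω) (fun i => M i ω) o ≤ r o} =
      {ω | ((fun n => X n ω), (fun i => M i ω)) ∈ S} := by
    ext ω
    simp only [S, reach, mem_ofPred_eq, iSup₂_le_iff]
  rw [h4, h1, h2, lintegral_const_mul' _ _ ENNReal.ofReal_ne_top,
    lintegral_prod_pow_of_poisson hN hNind s fun l => hG0 _]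

lemma measure_reach_none_le (c₀ : ℝ≥0∞) :
    P {ω | reach I (fun n => X n ω) (fun i => M i ω) none ≤ c₀} = ENNReal.ofReal (G c₀) := by
  have := measure_forall_reach_le hI hIdisj hX hMm hXM hM hG0 hG hN hNind ∅ fun _ => c₀
  simpa [Finset.mem_insertNone, Option.forall] using this

lemma measure_reach_some_le (l : ℕ) (c₀ : ℝ≥0∞) :
    P {ω | reach I (fun n => X n ω) (fun i => M i ω) (some l) ≤ c₀} =
      ENNReal.ofReal (Real.exp (-(c * (1 - G c₀)))) := by
  have h := measure_forall_reach_le hI hIdisj hX hMm hXM hM hG0 hG hN hNind {l}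
    fun o => if o = none then ∞ else c₀
  have hG1 : ENNReal.ofReal (G ∞) = 1 := by rw [← hG 0]; simp
  simpa [Finset.mem_insertNone, Option.forall, hG1] using h

/-- The largest marks in the different groups are independent. -/
lemma iIndepFun_reach :
    iIndepFun (fun (o : Option ℕ) ω => reach I (fun n => X n ω) (fun i => M i ω) o) P := by
  set R : Option ℕ → Ω → ℝ≥0∞ :=
    fun o ω => reach I (fun n => X n ω) (fun i => M i ω) o with hR
  have hRm : ∀ o, Measurable (R o) := measurable_reach hI hX hMm
  have hprod : ∀ (s : Finset ℕ) (r : Option ℕ → ℝ≥0∞),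
      P {ω | ∀ o ∈ s.insertNone, R o ω ≤ r o} =
        ∏ o ∈ s.insertNone, P {ω | R o ω ≤ r o} := fun s r => by
    rw [measure_forall_reach_le hI hIdisj hX hMm hXM hM hG0 hG hN hNind, Finset.prod_insertNone,
      measure_reach_none_le hI hIdisj hX hMm hXM hM hG0 hG hN hNind]
    simp_rw [hR, measure_reach_some_le hI hIdisj hX hMm hXM hM hG0 hG hN hNind]
  refine iIndepSets.iIndep (fun o => (hRm o).comap_le)
    (fun o => {S | ∃ t ∈ range (Iic : ℝ≥0∞ → Set ℝ≥0∞), R o ⁻¹' t = S})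
    (fun o => isPiSystem_Iic.comap (R o)) (fun o => ?_) ?_
  · rw [BorelSpace.measurable_eq (α := ℝ≥0∞), borel_eq_generateFrom_Iic,
      MeasurableSpace.comap_generateFrom]
    rfl
  · rw [iIndepSets_iff]
    intro s t ht
    have : ∀ o, ∃ b : ℝ≥0∞, (o ∈ s → R o ⁻¹' Iic b = t o) ∧ (o ∉ s → b = ⊤) := fun o => by
      by_cases ho : o ∈ s
      · obtain ⟨_, ⟨b, rfl⟩, hb⟩ := ht o ho
        exact ⟨b, fun _ => hb, fun h => absurd ho h⟩
      · exact ⟨⊤, fun h => absurd h ho, fun _ => rfl⟩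
    choose b hb hbtop using this
    have hsub : s ⊆ s.eraseNone.insertNone := by
      rw [Finset.insertNone_eraseNone]
      exact Finset.subset_insert _ _
    have h1 : (⋂ o ∈ s, t o) = {ω | ∀ o ∈ s.eraseNone.insertNone, R o ω ≤ b o} := by
      ext ω
      simp only [mem_iInter, mem_ofPred_eq]
      constructor
      · intro h o _
        by_cases ho : o ∈ s
        · have := h o ho
          rw [← hb o ho] at this
          exact this
        · rw [hbtop o ho]; exact le_top
      · intro h o ho
        rw [← hb o ho]
        exact h o (hsub ho)
    rw [h1, hprod, ← Finset.prod_subset hsub fun o _ ho => by rw [hbtop o ho]; simp]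
    exact Finset.prod_congr rfl fun o ho => by rw [← hb o ho]; rfl

end ReachLaw

/-! ### Discounted sums along a sequence with shrinking gaps -/

section Sequences

variable {a y : ℕ → ℝ} {μ : ℝ}

lemma gap_antitone (ha : StrictMono a) (hle : ∀ k, y k * (a (k + 1) - a k) ≤ 1)
    (hge : ∀ k, 1 ≤ y (k + 1) * (a (k + 1) - a k)) : Antitone fun k => a (k + 1) - a k := by
  refine antitone_nat_of_succ_le fun k => ?_
  have h1 := hle (k + 1)
  have h2 := hge k
  have h3 : 0 < a (k + 1) - a k := sub_pos.2 (ha (Nat.lt_succ_self k))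
  have hy : 0 < y (k + 1) := by
    by_contra! h
    nlinarith
  exact le_of_mul_le_mul_left (h1.trans h2) hy

/-- `discountedSum μ a k` is the discrete analogue of `∫ f(s) e^{-μ(t-s)} ds` over `[0, t]`, where
`t = a k`, when `f(s) ds` has mass `1` between consecutive points of the sequence `a`. -/
noncomputable def discountedSum (μ : ℝ) (a : ℕ → ℝ) (k : ℕ) : ℝ :=
  ∑ l ∈ Finset.range k, Real.exp (-(μ * (a k - a l)))

lemma discountedSum_nonneg (k : ℕ) : 0 ≤ discountedSum μ a k :=
  Finset.sum_nonneg fun _ _ => (Real.exp_pos _).le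

lemma discountedSum_succ (k : ℕ) : discountedSum μ a (k + 1) =
    Real.exp (-(μ * (a (k + 1) - a k))) * (discountedSum μ a k + 1) := by
  rw [discountedSum, Finset.sum_range_succ, discountedSum, mul_add, mul_one, Finset.mul_sum]
  congr 1
  refine Finset.sum_congr rfl fun l _ => ?_
  rw [← Real.exp_add]
  congr 1; ring

lemma sum_exp_succ_eq (k : ℕ) :
    ∑ l ∈ Finset.range k, Real.exp (-(μ * (a (k + 1) - a l))) =
      Real.exp (-(μ * (a (k + 1) - a k))) * discountedSum μ a k := by
  rw [discountedSum, Finset.mul_sum]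
  refine Finset.sum_congr rfl fun l _ => ?_
  rw [← Real.exp_add]
  congr 1; ring

/-- The discounted sums stay below the fixed point of their recursion, because the gaps shrink. -/
lemma discountedSum_mul_le (hanti : Antitone fun k => a (k + 1) - a k) (hμ : 0 < μ)
    (k : ℕ) :
    (1 - Real.exp (-(μ * (a (k + 1) - a k)))) * discountedSum μ a k ≤
      Real.exp (-(μ * (a (k + 1) - a k))) := by
  induction k with
  | zero => simp [discountedSum, Real.exp_nonneg]
  | succ k ih =>
    set w := Real.exp (-(μ * (a (k + 1) - a k))) with hw
    set w' := Real.exp (-(μ * (a (k + 1 + 1) - a (k + 1)))) with hw'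
    have hww' : w ≤ w' := Real.exp_le_exp.2 (neg_le_neg
      (mul_le_mul_of_nonneg_left (hanti (Nat.le_succ k)) hμ.le))
    have hU := discountedSum_nonneg (μ := μ) (a := a) k
    have hw0 : 0 < w := Real.exp_pos _
    rw [discountedSum_succ, ← hw]
    have h1 : (1 - w) * (w * (discountedSum μ a k + 1)) ≤ w := by nlinarith
    have h2 : 0 ≤ w * (discountedSum μ a k + 1) := by positivity
    nlinarith

lemma discountedSum_le_succ (hanti : Antitone fun k => a (k + 1) - a k) (hμ : 0 < μ)
    (k : ℕ) : discountedSum μ a k ≤ discountedSum μ a (k + 1) := by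
  have := discountedSum_mul_le hanti hμ k
  rw [discountedSum_succ]
  linarith

/-- With shrinking gaps, the discounted sum stays below `y / μ`, as `∫ f(s) e^{-μ(t-s)} ds` stays
below `f(t) / μ` for increasing `f`. -/
lemma discountedSum_le (ha : StrictMono a) (hanti : Antitone fun k => a (k + 1) - a k) (hμ : 0 < μ)
    (hy : ∀ k, 0 ≤ y k) (hge : ∀ k, 1 ≤ y (k + 1) * (a (k + 1) - a k)) (k : ℕ) :
    discountedSum μ a k ≤ y k / μ := by
  rcases k with _ | k
  · simpa [discountedSum] using div_nonneg (hy 0) hμ.le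
  · have h1 := discountedSum_mul_le hanti hμ k
    have hx : 0 < μ * (a (k + 1) - a k) := mul_pos hμ (sub_pos.2 (ha (Nat.lt_succ_self k)))
    rw [discountedSum_succ, le_div_iff₀ hμ]
    set U := discountedSum μ a k
    have hU : 0 ≤ U := discountedSum_nonneg k
    set x := μ * (a (k + 1) - a k) with hxdef
    have hw : Real.exp (-x) * (1 + x) ≤ 1 := by
      rw [Real.exp_neg, inv_mul_le_iff₀ (Real.exp_pos _)]
      linarith [Real.add_one_le_exp x]
    set w := Real.exp (-x)
    have hw0 : 0 < w := Real.exp_pos _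
    -- Since `w x ≤ 1 - w`, this follows from `(1 - w) (U + 1) ≤ 1`, which is `h1`.
    have h2 : x * (w * (U + 1)) ≤ 1 := by nlinarith
    have h3 := hge k
    have hh : 0 < a (k + 1) - a k := sub_pos.2 (ha (Nat.lt_succ_self k))
    have h4 : (w * (U + 1) * μ) * (a (k + 1) - a k) ≤ y (k + 1) * (a (k + 1) - a k) := by
      have : w * (U + 1) * μ * (a (k + 1) - a k) = x * (w * (U + 1)) := by rw [hxdef]; ring
      rw [this]; exact h2.trans h3
    exact le_of_mul_le_mul_right h4 hh

/-- The lower bound for the gap probabilities that makes the model transient. -/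
lemma exp_neg_le_exp_neg_sum (ha : StrictMono a)
    (hanti : Antitone fun k => a (k + 1) - a k) (hμ : 0 < μ) (hy : ∀ k, 0 ≤ y k)
    (hge : ∀ k, 1 ≤ y (k + 1) * (a (k + 1) - a k)) (k : ℕ) :
    Real.exp (-1) * Real.exp (-(y k / μ)) ≤
      Real.exp (-∑ l ∈ Finset.range k, Real.exp (-(μ * (a k - a (l + 1))))) := by
  rw [← Real.exp_add, Real.exp_le_exp]
  have h1 := discountedSum_le ha hanti hμ hy hge k
  have h2 : ∑ l ∈ Finset.range k, Real.exp (-(μ * (a k - a (l + 1)))) ≤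
      discountedSum μ a k + 1 := by
    have h3 := Finset.sum_range_succ' (fun l => Real.exp (-(μ * (a k - a l)))) k
    rw [Finset.sum_range_succ] at h3
    simp only [sub_self, mul_zero, neg_zero, Real.exp_zero] at h3
    have := Real.exp_pos (-(μ * (a k - a 0)))
    rw [discountedSum]
    linarith
  linarith

/-- Telescoping bound with the potential `(2 + u) e^{-u}`, an antiderivative of
`-(1 + u) e^{-u}`. -/
lemma sub_mul_exp_neg_le {u v : ℝ} (hu : 0 ≤ u) (huv : u ≤ v) :
    (v - u) * (1 + v) * Real.exp (-v) ≤
      (2 + u) * Real.exp (-u) - (2 + v) * Real.exp (-v) := by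
  have h1 : Real.exp (-u) = Real.exp (v - u) * Real.exp (-v) := by
    rw [← Real.exp_add]; congr 1; ring
  have h2 := Real.quadratic_le_exp_of_nonneg (sub_nonneg.2 huv)
  rw [h1]
  have h3 : (v - u) * (1 + v) + (2 + v) ≤ (2 + u) * Real.exp (v - u) := by
    nlinarith [mul_le_mul_of_nonneg_left h2 (by linarith : 0 ≤ 2 + u), sq_nonneg (v - u),
      mul_nonneg hu (sq_nonneg (v - u))]
  nlinarith [Real.exp_pos (-v)]

/-- The comparison behind recurrence. Where the discounted sum `U` is within a bounded distance of
its fixed point, it is `y k / μ` up to a constant. Elsewhere it grows by a fixed proportion of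
`1 / (1 + U)`, and these steps are controlled by telescoping. -/
lemma summable_exp_neg_sum (ha : StrictMono a)
    (hanti : Antitone fun k => a (k + 1) - a k) (hμ : 0 < μ)
    (hle : ∀ k, y k * (a (k + 1) - a k) ≤ 1)
    (hs : Summable fun k => Real.exp (-(y k / μ))) :
    Summable fun k =>
      Real.exp (-∑ l ∈ Finset.range k, Real.exp (-(μ * (a (k + 1) - a l)))) := by
  set U := discountedSum μ a with hUdef
  set w : ℕ → ℝ := fun k => Real.exp (-(μ * (a (k + 1) - a k))) with hw
  have hU0 : ∀ k, 0 ≤ U k := discountedSum_nonneg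
  have hUs : ∀ k, U k ≤ U (k + 1) := discountedSum_le_succ hanti hμ
  have hrec : ∀ k, U (k + 1) = w k * (U k + 1) := discountedSum_succ
  have hw0 : ∀ k, w 0 ≤ w k := fun k => Real.exp_le_exp.2 (neg_le_neg
      (mul_le_mul_of_nonneg_left (hanti (Nat.zero_le k)) hμ.le))
  have hwpos : 0 < w 0 := Real.exp_pos _
  have hw1 : ∀ k, w k < 1 := fun k => Real.exp_lt_one_iff.2
    (neg_neg_of_pos (mul_pos hμ (sub_pos.2 (ha (Nat.lt_succ_self k)))))
  let H : ℕ → ℝ := fun k => (2 + U k) * Real.exp (-U k)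
  have htel : ∀ k, (U (k + 1) - U k) * (1 + U (k + 1)) * Real.exp (-U (k + 1)) ≤ H k - H (k + 1) :=
    fun k => sub_mul_exp_neg_le (hU0 k) (hUs k)
  have hH : ∀ k, 0 ≤ H k - H (k + 1) := fun k => le_trans (by
    have := hUs k; have := hU0 (k + 1)
    exact mul_nonneg (mul_nonneg (by linarith) (by linarith)) (Real.exp_pos _).le) (htel k)
  have hHs : Summable fun k => H k - H (k + 1) := by
    refine summable_of_sum_range_le (c := H 0) hH fun n => ?_
    rw [Finset.sum_range_sub']
    have : 0 ≤ H n := mul_nonneg (by linarith [hU0 n]) (Real.exp_pos _).le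
    linarith
  have hbound : ∀ k, Real.exp (-U (k + 1)) ≤
      Real.exp 2 * Real.exp (-(y k / μ)) + (w 0)⁻¹ * (H k - H (k + 1)) := by
    intro k
    have hE : 0 < Real.exp (-U (k + 1)) := Real.exp_pos _
    rcases le_or_gt (U (k + 1) - U k) (1 - w k) with hD | hD
    · have hnear : y k / μ - 2 ≤ U k := by
        set x := μ * (a (k + 1) - a k) with hx
        have hxpos : 0 < x := mul_pos hμ (sub_pos.2 (ha (Nat.lt_succ_self k)))
        have h1 : 1 - w k ≤ x := by
          have := Real.add_one_le_exp (-x)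
          simp only [hw]
          linarith
        rw [hrec] at hD
        have h2 : 1 ≤ (1 - w k) * (U k + 2) := by linarith
        have h3 : 1 ≤ x * (U k + 2) :=
          h2.trans (mul_le_mul_of_nonneg_right h1 (by linarith [hU0 k]))
        have h4 : y k * (a (k + 1) - a k) ≤ (U k + 2) * μ * (a (k + 1) - a k) := by
          have : (U k + 2) * μ * (a (k + 1) - a k) = x * (U k + 2) := by rw [hx]; ring
          rw [this]; exact (hle k).trans h3
        have h5 := le_of_mul_le_mul_right h4 (sub_pos.2 (ha (Nat.lt_succ_self k)))
        have := (div_le_iff₀ hμ).2 h5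
        linarith
      have : Real.exp (-U (k + 1)) ≤ Real.exp 2 * Real.exp (-(y k / μ)) := by
        rw [← Real.exp_add, Real.exp_le_exp]
        linarith [hUs k]
      have := mul_nonneg (inv_nonneg.2 hwpos.le) (hH k)
      linarith
    · have h1 : w 0 ≤ (U (k + 1) - U k) * (1 + U (k + 1)) := by
        have h2 : w k ≤ (U (k + 1) - U k) * (1 + U k) := by
          have := mul_le_mul_of_nonneg_right hD.le (hU0 k)
          have := hrec k
          nlinarith
        have h3 : (U (k + 1) - U k) * (1 + U k) ≤ (U (k + 1) - U k) * (1 + U (k + 1)) :=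
          mul_le_mul_of_nonneg_left (by linarith [hUs k]) (by linarith [hUs k])
        linarith [hw0 k]
      have h4 : Real.exp (-U (k + 1)) ≤ (w 0)⁻¹ * (H k - H (k + 1)) := by
        rw [le_inv_mul_iff₀ hwpos]
        exact (mul_le_mul_of_nonneg_right h1 hE.le).trans (htel k)
      have : 0 ≤ Real.exp 2 * Real.exp (-(y k / μ)) := by positivity
      linarith
  have hsum : Summable fun k => Real.exp (-U (k + 1)) :=
    Summable.of_nonneg_of_le (fun _ => (Real.exp_pos _).le) hbound
      ((hs.mul_left _).add (hHs.mul_left _))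
  refine Summable.of_nonneg_of_le (fun _ => (Real.exp_pos _).le) (fun k => ?_)
    (hsum.mul_left (Real.exp 1))
  rw [sum_exp_succ_eq, ← Real.exp_add, Real.exp_le_exp]
  have := hrec k
  have := hw1 k
  simp only [hw, hUdef] at *
  linarith

end Sequences

/-! ### Cutting the half-line into intervals of unit mass -/

section Bins

/-- Cutting points of `[0, ∞)` into intervals of mass `1` for the measure `f(t) dt`. -/
lemma exists_bins {f : ℝ → ℝ} (hf_nonneg : ∀ t, 0 ≤ t → 0 ≤ f t) (hf_mono : MonotoneOn f (Ici 0))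
    (hf_ne : ∃ t, 0 ≤ t ∧ f t ≠ 0) :
    ∃ a : ℕ → ℝ, a 0 = 0 ∧ StrictMono a ∧ Tendsto a atTop atTop ∧
      ∀ k, ∫⁻ t in Ico (a k) (a (k + 1)), ENNReal.ofReal (f t) = 1 := by
  set F : ℝ → ℝ := fun t => ∫ s in (0)..t, f s with hF
  have hint : ∀ s t, 0 ≤ s → 0 ≤ t → IntervalIntegrable f volume s t := fun s t hs ht =>
    (hf_mono.mono fun u hu => (le_min hs ht).trans hu.1).intervalIntegrable
  have hadd : ∀ s t, 0 ≤ s → 0 ≤ t → F t - F s = ∫ u in s..t, f u := fun s t hs ht =>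
    intervalIntegral.integral_interval_sub_left (hint 0 t le_rfl ht) (hint 0 s le_rfl hs)
  have hFmono : ∀ s t, 0 ≤ s → s ≤ t → F s ≤ F t := fun s t hs hst => by
    rw [← sub_nonneg, hadd s t hs (hs.trans hst)]
    exact intervalIntegral.integral_nonneg hst fun u hu => hf_nonneg u (hs.trans hu.1)
  obtain ⟨t₀, ht₀, hft₀⟩ := hf_ne
  have hft₀ : 0 < f t₀ := lt_of_le_of_ne (hf_nonneg t₀ ht₀) hft₀.symm
  have hlarge : ∀ c : ℝ, 0 ≤ c → c ≤ F (t₀ + c / f t₀) := by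
    intro c hc
    have hc' : 0 ≤ c / f t₀ := div_nonneg hc hft₀.le
    have h1 : ∫ u in t₀..(t₀ + c / f t₀), f t₀ ≤ ∫ u in t₀..(t₀ + c / f t₀), f u :=
      intervalIntegral.integral_mono_on (by linarith) intervalIntegrable_const
        (hint _ _ ht₀ (by linarith)) fun u hu => hf_mono ht₀ (ht₀.trans hu.1 : 0 ≤ u) hu.1
    rw [intervalIntegral.integral_const, smul_eq_mul, add_sub_cancel_left,
      div_mul_cancel₀ _ hft₀.ne', ← hadd _ _ ht₀ (by linarith)] at h1
    have h2 : 0 ≤ F t₀ := by simpa [hF] using hFmono 0 t₀ le_rfl ht₀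
    linarith
  have hex : ∀ k : ℕ, ∃ t, 0 ≤ t ∧ F t = k ∧ (k = 0 → t = 0) := by
    intro k
    rcases Nat.eq_zero_or_pos k with rfl | hk
    · exact ⟨0, le_rfl, by simp [hF], fun _ => rfl⟩
    · set T := t₀ + (k : ℝ) / f t₀
      have hT : 0 ≤ T := by positivity
      have hcont : ContinuousOn F (Icc 0 T) := by
        have := intervalIntegral.continuousOn_primitive_interval
          ((intervalIntegrable_iff_integrableOn_Icc_of_le hT).1 (hint 0 T le_rfl hT) |>.mono_set
            (by rw [uIcc_of_le hT]))
        rwa [uIcc_of_le hT] at this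
      obtain ⟨t, ht, hFt⟩ := intermediate_value_Icc hT hcont
        ⟨by simp [hF], hlarge k (Nat.cast_nonneg k)⟩
      exact ⟨t, ht.1, hFt, fun h => absurd h hk.ne'⟩
  choose a ha0 haF hazero using hex
  have hmono : StrictMono a := strictMono_nat_of_lt_succ fun k => by
    by_contra! h
    have := hFmono _ _ (ha0 (k + 1)) h
    rw [haF, haF] at this
    push_cast at this
    linarith
  refine ⟨a, hazero 0 rfl, hmono, ?_, fun k => ?_⟩
  · refine tendsto_atTop_mono' _ (f₁ := fun k : ℕ => a k) (Eventually.of_forall fun k => le_rfl) ?_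
    refine tendsto_atTop_atTop_of_monotone hmono.monotone fun b => ?_
    by_contra! h
    obtain ⟨n, hn⟩ := exists_nat_gt (F (max b 0))
    have := hFmono _ _ (ha0 n) ((h n).le.trans (le_max_left b 0))
    rw [haF] at this
    linarith
  · have hle : a k ≤ a (k + 1) := (hmono (Nat.lt_succ_self k)).le
    have hI := (intervalIntegrable_iff_integrableOn_Ico_of_le hle).1 (hint _ _ (ha0 k) (ha0 (k + 1)))
    rw [← ofReal_integral_eq_lintegral_ofReal hI, integral_Ico_eq_integral_Ioc,
      ← intervalIntegral.integral_of_le hle, ← hadd _ _ (ha0 k) (ha0 _), haF, haF]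
    · simp
    · exact (ae_restrict_iff' measurableSet_Ico).2
        (ae_of_all _ fun t ht => hf_nonneg t ((ha0 k).trans ht.1))

variable {f : ℝ → ℝ} {a : ℕ → ℝ}

lemma mul_gap_bounds (hf_nonneg : ∀ t, 0 ≤ t → 0 ≤ f t) (hf_mono : MonotoneOn f (Ici 0))
    {s t : ℝ} (hs : 0 ≤ s) (hst : s ≤ t) (hone : ∫⁻ u in Ico s t, ENNReal.ofReal (f u) = 1) :
    f s * (t - s) ≤ 1 ∧ 1 ≤ f t * (t - s) := by
  have hts : 0 ≤ t - s := sub_nonneg.2 hst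
  constructor
  · have h : ENNReal.ofReal (f s) * volume (Ico s t) ≤ 1 := by
      rw [← hone, ← setLIntegral_const]
      exact setLIntegral_mono' measurableSet_Ico fun u hu =>
        ENNReal.ofReal_le_ofReal (hf_mono hs (hs.trans hu.1 : 0 ≤ u) hu.1)
    rwa [Real.volume_Ico, ← ENNReal.ofReal_mul (hf_nonneg s hs), ENNReal.ofReal_le_one] at h
  · have h : 1 ≤ ENNReal.ofReal (f t) * volume (Ico s t) := by
      rw [← hone, ← setLIntegral_const]
      exact setLIntegral_mono' measurableSet_Ico fun u hu =>
        ENNReal.ofReal_le_ofReal (hf_mono (hs.trans hu.1 : 0 ≤ u) (hs.trans hst) hu.2.le)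
    rwa [Real.volume_Ico, ← ENNReal.ofReal_mul (hf_nonneg t (hs.trans hst)),
      ENNReal.one_le_ofReal] at h

lemma iUnion_Ico_bins (h0 : a 0 = 0) (ha : StrictMono a) (htop : Tendsto a atTop atTop) :
    ⋃ k, Ico (a k) (a (k + 1)) = Ici 0 := by
  classical
  ext t
  simp only [mem_iUnion, mem_Ici]
  constructor
  · rintro ⟨k, hk⟩
    exact (h0 ▸ ha.monotone (Nat.zero_le k)).trans hk.1
  · intro ht
    have hex : ∃ n, t < a n := (htop.eventually_gt_atTop t).exists
    have hpos : Nat.find hex ≠ 0 := fun h => by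
      have := Nat.find_spec hex
      rw [h, h0] at this
      linarith
    refine ⟨Nat.find hex - 1, not_lt.1 (Nat.find_min hex (by omega)), ?_⟩
    rw [Nat.sub_add_cancel (Nat.one_le_iff_ne_zero.2 hpos)]
    exact Nat.find_spec hex

lemma pairwise_disjoint_Ico_bins (ha : StrictMono a) :
    Pairwise (Function.onFun Disjoint fun k => Ico (a k) (a (k + 1))) :=
  ha.monotone.pairwise_disjoint_on_Ico_succ

lemma lintegral_eq_top_iff_not_summable
    (hf_mono : MonotoneOn f (Ici 0)) (h0 : a 0 = 0) (ha : StrictMono a)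
    (htop : Tendsto a atTop atTop)
    (hone : ∀ k, ∫⁻ t in Ico (a k) (a (k + 1)), ENNReal.ofReal (f t) = 1) {μ : ℝ} (hμ : 0 < μ) :
    ∫⁻ t in Ici (0 : ℝ), ENNReal.ofReal (Real.exp (-(f t) / μ) * f t) = ∞ ↔
      ¬ Summable fun k => Real.exp (-(f (a k) / μ)) := by
  have ha0 : ∀ k, 0 ≤ a k := fun k => h0 ▸ ha.monotone (Nat.zero_le k)
  have hsplit : ∀ t, ENNReal.ofReal (Real.exp (-(f t) / μ) * f t) =
      ENNReal.ofReal (Real.exp (-(f t / μ))) * ENNReal.ofReal (f t) := fun t => by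
    rw [ENNReal.ofReal_mul (Real.exp_pos _).le, neg_div]
  rw [← iUnion_Ico_bins h0 ha htop, lintegral_iUnion (fun _ => measurableSet_Ico)
    (pairwise_disjoint_Ico_bins ha)]
  simp_rw [hsplit]
  have hup : ∀ k, ∫⁻ t in Ico (a k) (a (k + 1)),
      ENNReal.ofReal (Real.exp (-(f t / μ))) * ENNReal.ofReal (f t) ≤
      ENNReal.ofReal (Real.exp (-(f (a k) / μ))) := fun k => by
    calc _ ≤ ∫⁻ t in Ico (a k) (a (k + 1)),
          ENNReal.ofReal (Real.exp (-(f (a k) / μ))) * ENNReal.ofReal (f t) := by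
          refine setLIntegral_mono' measurableSet_Ico fun t ht => ?_
          have := hf_mono (ha0 k) ((ha0 k).trans ht.1 : 0 ≤ t) ht.1
          gcongr
      _ = _ := by rw [lintegral_const_mul' _ _ ENNReal.ofReal_ne_top, hone, mul_one]
  have hlow : ∀ k, ENNReal.ofReal (Real.exp (-(f (a (k + 1)) / μ))) ≤
      ∫⁻ t in Ico (a k) (a (k + 1)),
        ENNReal.ofReal (Real.exp (-(f t / μ))) * ENNReal.ofReal (f t) := fun k => by
    calc _ = ∫⁻ t in Ico (a k) (a (k + 1)),
          ENNReal.ofReal (Real.exp (-(f (a (k + 1)) / μ))) * ENNReal.ofReal (f t) := by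
          rw [lintegral_const_mul' _ _ ENNReal.ofReal_ne_top, hone, mul_one]
      _ ≤ _ := by
          refine setLIntegral_mono' measurableSet_Ico fun t ht => ?_
          have := hf_mono ((ha0 k).trans ht.1 : 0 ≤ t) (ha0 (k + 1)) ht.2.le
          gcongr
  rw [← not_iff_not, not_not]
  constructor
  · intro h
    have h1 : ∑' k, ENNReal.ofReal (Real.exp (-(f (a (k + 1)) / μ))) ≠ ∞ :=
      ne_top_of_le_ne_top h (ENNReal.tsum_le_tsum hlow)
    have h2 := ENNReal.summable_toReal h1
    simp_rw [ENNReal.toReal_ofReal (Real.exp_pos _).le] at h2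
    exact (summable_nat_add_iff 1).1 h2
  · intro h
    refine ne_top_of_le_ne_top ?_ (ENNReal.tsum_le_tsum hup)
    exact h.tsum_ofReal_ne_top

end Bins

/-! ### A renewal argument for gaps -/

section Renewal

variable {Ω : Type*} [MeasurableSpace Ω] {P : Measure Ω}
  {R : ℕ → Ω → ℝ≥0∞} {φ : ℝ≥0∞ → ℝ≥0∞} {b : ℕ → ℕ → ℝ≥0∞}

/-- The event that none of the first `k` groups reaches level `k`, where `b k l` is the distance
that group `l` would have to bridge. -/
def gapEvent (R : ℕ → Ω → ℝ≥0∞) (b : ℕ → ℕ → ℝ≥0∞) (k : ℕ) : Set Ω :=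
  {ω | ∀ l < k, R l ω ≤ b k l}

lemma measurableSet_gapEvent (hRm : ∀ l, Measurable (R l)) (k : ℕ) :
    MeasurableSet (gapEvent R b k) := by
  have : gapEvent R b k = ⋂ l ∈ Finset.range k, R l ⁻¹' Iic (b k l) := by
    ext ω; simp [gapEvent]
  rw [this]
  exact Finset.measurableSet_biInter _ fun l _ => hRm l measurableSet_Iic

lemma measure_forall_Ico_le (hR : iIndepFun R P) (hφ : ∀ l c, P {ω | R l ω ≤ c} = φ c)
    (j k : ℕ) (c : ℕ → ℝ≥0∞) :
    P {ω | ∀ l ∈ Finset.Ico j k, R l ω ≤ c l} = ∏ l ∈ Finset.Ico j k, φ (c l) := by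
  have : {ω | ∀ l ∈ Finset.Ico j k, R l ω ≤ c l} =
      ⋂ l ∈ Finset.Ico j k, R l ⁻¹' Iic (c l) := by
    ext ω; simp
  rw [this, hR.measure_inter_preimage_eq_mul _ fun _ _ => measurableSet_Iic]
  exact Finset.prod_congr rfl fun l _ => hφ l _

lemma measure_gapEvent (hR : iIndepFun R P) (hφ : ∀ l c, P {ω | R l ω ≤ c} = φ c) (k : ℕ) :
    P (gapEvent R b k) = ∏ l ∈ Finset.range k, φ (b k l) := by
  have := measure_forall_Ico_le hR hφ 0 k (b k)
  rw [← Finset.range_eq_Ico] at this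
  rw [← this]
  congr 1
  ext ω; simp [gapEvent]

/-- The event that `k` is the first index from `K` on at which a gap occurs. -/
def firstGap (R : ℕ → Ω → ℝ≥0∞) (b : ℕ → ℕ → ℝ≥0∞) (K k : ℕ) : Set Ω :=
  {ω | K ≤ k ∧ ω ∈ gapEvent R b k ∧ ∀ j, K ≤ j → j < k → ω ∉ gapEvent R b j}

/-- After a gap at `k`, only the groups from `k` on can prevent a gap at `n`, and since the
distances shrink they are less likely to leave a gap than in a system started afresh. -/
lemma measure_firstGap_inter_le (hR : iIndepFun R P) (hRm : ∀ l, Measurable (R l))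
    (hφ : ∀ l c, P {ω | R l ω ≤ c} = φ c) (hb : ∀ k m l, l < m → b (k + m) (k + l) ≤ b m l)
    (K : ℕ) {k n : ℕ} (hkn : k ≤ n) :
    P (firstGap R b K k ∩ gapEvent R b n) ≤
      P (firstGap R b K k) * P (gapEvent R b (n - k)) := by
  let S : Set (Finset.range k → ℝ≥0∞) :=
    {_u | K ≤ k} ∩ ((⋂ l : Finset.range k, {u | u l ≤ b k l}) ∩
      ⋂ (j : ℕ) (_ : K ≤ j) (_ : j < k), (⋂ (l : Finset.range k) (_ : (l : ℕ) < j),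
        {u : Finset.range k → ℝ≥0∞ | u l ≤ b j l})ᶜ)
  have hS : MeasurableSet S :=
    (MeasurableSet.const _).inter (MeasurableSet.inter
      (MeasurableSet.iInter fun l => measurableSet_le (measurable_pi_apply l) measurable_const)
      (MeasurableSet.iInter fun j => MeasurableSet.iInter fun _ => MeasurableSet.iInter fun _ =>
        (MeasurableSet.iInter fun l => MeasurableSet.iInter fun _ =>
          measurableSet_le (measurable_pi_apply l) measurable_const).compl))
  have hSpre : firstGap R b K k = (fun ω (l : Finset.range k) => R l ω) ⁻¹' S := by
    ext ω
    simp only [firstGap, gapEvent, S, mem_ofPred_eq, mem_preimage, mem_inter_iff, mem_iInter,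
      mem_compl_iff, Subtype.forall, Finset.mem_range]
    refine and_congr_right fun _ => and_congr_right fun _ => ?_
    refine forall_congr' fun j => forall_congr' fun _ => forall_congr' fun hj => not_congr ?_
    exact ⟨fun h l _ hl => h l hl, fun h l hl => h l (hl.trans hj) hl⟩
  let S' : Set (Finset.Ico k n → ℝ≥0∞) := ⋂ l : Finset.Ico k n, {u | u l ≤ b n l}
  have hS' : MeasurableSet S' :=
    MeasurableSet.iInter fun l => measurableSet_le (measurable_pi_apply l) measurable_const
  have hS'pre : {ω | ∀ l ∈ Finset.Ico k n, R l ω ≤ b n l} =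
      (fun ω (l : Finset.Ico k n) => R l ω) ⁻¹' S' := by
    ext ω
    simp [S']
  have hdisj : Disjoint (Finset.range k) (Finset.Ico k n) :=
    Finset.disjoint_left.2 fun l h1 h2 => by
      rw [Finset.mem_range] at h1
      rw [Finset.mem_Ico] at h2
      omega
  have hind := (hR.indepFun_finset _ _ hdisj hRm).measure_inter_preimage_eq_mul _ _ hS hS'
  rw [← hSpre, ← hS'pre] at hind
  calc P (firstGap R b K k ∩ gapEvent R b n)
      ≤ P (firstGap R b K k ∩ {ω | ∀ l ∈ Finset.Ico k n, R l ω ≤ b n l}) :=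
        measure_mono (inter_subset_inter_right _ fun ω hω l hl => hω l (Finset.mem_Ico.1 hl).2)
    _ = _ := hind
    _ ≤ _ := by
        refine mul_le_mul_right ?_ _
        rw [measure_forall_Ico_le hR hφ, measure_gapEvent hR hφ, Finset.prod_Ico_eq_prod_range]
        refine Finset.prod_le_prod' fun l hl => ?_
        have h := hb k (n - k) l (Finset.mem_range.1 hl)
        rw [Nat.add_sub_cancel' hkn] at h
        rw [← hφ 0, ← hφ 0]
        exact measure_mono fun ω hω => le_trans hω h

/-- If the expected number of gaps is infinite, then almost surely gaps occur arbitrarily late. -/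
lemma ae_exists_gapEvent [IsProbabilityMeasure P] (hR : iIndepFun R P) (hRm : ∀ l, Measurable (R l))
    (hφ : ∀ l c, P {ω | R l ω ≤ c} = φ c) (hb : ∀ k m l, l < m → b (k + m) (k + l) ≤ b m l)
    (hsum : ∑' k, P (gapEvent R b k) = ∞) (K : ℕ) :
    ∀ᵐ ω ∂P, ∃ k ≥ K, ω ∈ gapEvent R b k := by
  classical
  have hDm : ∀ k, MeasurableSet (gapEvent R b k) := measurableSet_gapEvent hRm
  have hTm : ∀ k, MeasurableSet (firstGap R b K k) := fun k => by
    refine (MeasurableSet.const _).inter ((hDm k).inter ?_)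
    have : (⋂ (j : ℕ) (_ : K ≤ j) (_ : j < k), (gapEvent R b j)ᶜ) =
        {ω | ∀ j, K ≤ j → j < k → ω ∉ gapEvent R b j} := by ext ω; simp
    change MeasurableSet {ω | ∀ j, K ≤ j → j < k → ω ∉ gapEvent R b j}
    rw [← this]
    exact MeasurableSet.iInter fun j => MeasurableSet.iInter fun _ => MeasurableSet.iInter fun _ =>
      (hDm j).compl
  have hTdisj : Pairwise (Function.onFun Disjoint (firstGap R b K)) := by
    have key : ∀ i j, i < j → Disjoint (firstGap R b K i) (firstGap R b K j) := fun i j hij =>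
      disjoint_left.2 fun ω hi hj => hj.2.2 i hi.1 hij hi.2.1
    intro i j hij
    rcases hij.lt_or_gt with h | h
    exacts [key i j h, (key j i h).symm]
  set p := P (⋃ k, firstGap R b K k) with hp
  have hfirst : ∀ n, K ≤ n → ∀ ω ∈ gapEvent R b n, ∃ k ≤ n, ω ∈ firstGap R b K k := by
    intro n hn ω hω
    have hex : ∃ k, K ≤ k ∧ ω ∈ gapEvent R b k := ⟨n, hn, hω⟩
    exact ⟨Nat.find hex, Nat.find_min' hex ⟨hn, hω⟩, (Nat.find_spec hex).1, (Nat.find_spec hex).2,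
      fun j hj hjk hjω => Nat.find_min hex hjk ⟨hj, hjω⟩⟩
  have hdecomp : ∀ n, P (gapEvent R b n) ≤ (if n < K then 1 else 0) +
      ∑ k ∈ Finset.range (n + 1), P (firstGap R b K k) * P (gapEvent R b (n - k)) := by
    intro n
    split_ifs with h
    · exact prob_le_one.trans le_self_add
    · rw [zero_add]
      have hsub : gapEvent R b n ⊆
          ⋃ k ∈ Finset.range (n + 1), firstGap R b K k ∩ gapEvent R b n := by
        intro ω hω
        obtain ⟨k, hk, hkω⟩ := hfirst n (not_lt.1 h) ω hω
        exact mem_iUnion₂.2 ⟨k, Finset.mem_range.2 (Nat.lt_succ_of_le hk), hkω, hω⟩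
      refine (measure_mono hsub).trans ((measure_biUnion_finset_le _ _).trans ?_)
      exact Finset.sum_le_sum fun k hk => measure_firstGap_inter_le hR hRm hφ hb K
        (Nat.lt_succ_iff.1 (Finset.mem_range.1 hk))
  let s : ℕ → ℝ≥0∞ := fun H => ∑ n ∈ Finset.range H, P (gapEvent R b n)
  have hs_fin : ∀ H, s H ≠ ∞ := fun H => ENNReal.sum_ne_top.2 fun n _ => measure_ne_top _ _
  -- The renewal inequality, summed up to `H`. As `s H → ∞`, it forces `p = 1`.
  have hren : ∀ H, s H ≤ K + p * s H := by
    intro H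
    calc s H ≤ ∑ n ∈ Finset.range H, ((if n < K then 1 else 0) +
          ∑ k ∈ Finset.range (n + 1), P (firstGap R b K k) * P (gapEvent R b (n - k))) :=
          Finset.sum_le_sum fun n _ => hdecomp n
      _ = (∑ n ∈ Finset.range H, if n < K then (1 : ℝ≥0∞) else 0) +
          ∑ n ∈ Finset.range H, ∑ k ∈ Finset.range (n + 1),
            P (firstGap R b K k) * P (gapEvent R b (n - k)) := Finset.sum_add_distrib
      _ ≤ _ := by
        gcongr
        · rw [← Finset.sum_filter, Finset.sum_const, nsmul_eq_mul, mul_one]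
          norm_cast
          refine (Finset.card_le_card (t := Finset.range K) fun n hn => ?_).trans
            (Finset.card_range K).le
          exact Finset.mem_range.2 (Finset.mem_filter.1 hn).2
        · rw [Finset.sum_comm' (t' := Finset.range H) (s' := fun k => Finset.Ico k H) (by
            intro n k
            simp only [Finset.mem_range, Finset.mem_Ico]
            omega)]
          calc _ ≤ ∑ k ∈ Finset.range H, P (firstGap R b K k) * s H := by
                refine Finset.sum_le_sum fun k _ => ?_
                rw [← Finset.mul_sum, Finset.sum_Ico_eq_sum_range]
                gcongr
                simp only [add_tsub_cancel_left]
                exact Finset.sum_le_sum_of_subset (Finset.range_mono (Nat.sub_le H k))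
            _ = (∑ k ∈ Finset.range H, P (firstGap R b K k)) * s H := by rw [Finset.sum_mul]
            _ ≤ p * s H := by
                gcongr
                rw [hp, measure_iUnion hTdisj hTm]
                exact ENNReal.sum_le_tsum _
  have hp1 : p = 1 := by
    by_contra hne
    have hlt : p < 1 := lt_of_le_of_ne prob_le_one hne
    have hpos : 1 - p ≠ 0 := (tsub_pos_of_lt hlt).ne'
    have hbd : ∀ H, s H ≤ K / (1 - p) := by
      intro H
      rw [ENNReal.le_div_iff_mul_le (Or.inl hpos) (Or.inl (by finiteness)), mul_comm,
        ENNReal.sub_mul fun _ _ => hs_fin H, one_mul]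
      exact tsub_le_iff_right.2 (hren H)
    have : ∑' k, P (gapEvent R b k) ≤ K / (1 - p) := by
      rw [ENNReal.tsum_eq_iSup_nat]
      exact iSup_le hbd
    rw [hsum, top_le_iff] at this
    exact ENNReal.div_ne_top (ENNReal.natCast_ne_top K) hpos this
  have hae : ∀ᵐ ω ∂P, ω ∈ ⋃ k, firstGap R b K k := by
    rw [← prob_compl_eq_zero_iff (MeasurableSet.iUnion hTm)] at hp1
    exact hp1
  filter_upwards [hae] with ω hω
  obtain ⟨k, hk⟩ := mem_iUnion.1 hω
  exact ⟨k, hk.1, hk.2.1⟩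

end Renewal

/-! ### The frog model -/

section Assembly

/-- The points `a 0 = 0 < a 1 < a 2 < …` tend to infinity and cut `[0, ∞)` into intervals that have
mass `1` for the measure `f(t) dt`. -/
structure IsUnitCut (f : ℝ → ℝ) (a : ℕ → ℝ) : Prop where
  zero : a 0 = 0
  strictMono : StrictMono a
  tendsto : Tendsto a atTop atTop
  mass : ∀ k, ∫⁻ t in Ico (a k) (a (k + 1)), ENNReal.ofReal (f t) = 1

variable {f : ℝ → ℝ} {a : ℕ → ℝ}

lemma IsUnitCut.nonneg (ha : IsUnitCut f a) (k : ℕ) : 0 ≤ a k :=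
  ha.zero ▸ ha.strictMono.monotone (Nat.zero_le k)

lemma IsUnitCut.exists_mem (ha : IsUnitCut f a) {t : ℝ} (ht : 0 ≤ t) :
    ∃ k, t ∈ Ico (a k) (a (k + 1)) := by
  have : t ∈ ⋃ k, Ico (a k) (a (k + 1)) := by
    rw [iUnion_Ico_bins ha.zero ha.strictMono ha.tendsto]
    exact ht
  exact mem_iUnion.1 this

lemma IsUnitCut.gap_bounds (ha : IsUnitCut f a) (hf_nonneg : ∀ t, 0 ≤ t → 0 ≤ f t)
    (hf_mono : MonotoneOn f (Ici 0)) (k : ℕ) :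
    f (a k) * (a (k + 1) - a k) ≤ 1 ∧ 1 ≤ f (a (k + 1)) * (a (k + 1) - a k) :=
  mul_gap_bounds hf_nonneg hf_mono (ha.nonneg k) (ha.strictMono (Nat.lt_succ_self k)).le (ha.mass k)

lemma IsUnitCut.antitone (ha : IsUnitCut f a) (hf_nonneg : ∀ t, 0 ≤ t → 0 ≤ f t)
    (hf_mono : MonotoneOn f (Ici 0)) : Antitone fun k => a (k + 1) - a k :=
  gap_antitone (y := fun k => f (a k)) ha.strictMono
    (fun k => (ha.gap_bounds hf_nonneg hf_mono k).1) fun k => (ha.gap_bounds hf_nonneg hf_mono k).2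

lemma sub_shift_le (hanti : Antitone fun k => a (k + 1) - a k) (k : ℕ) {p q : ℕ} (hpq : p ≤ q) :
    a (k + q) - a (k + p) ≤ a q - a p := by
  induction q, hpq using Nat.le_induction with
  | base => simp
  | succ q _ ih =>
    have : a (k + q + 1) - a (k + q) ≤ a (q + 1) - a q := hanti (Nat.le_add_left q k)
    rw [← add_assoc]
    linarith

/-- The interval with number `l` of the partition of `[0, ∞)` at the points of `a`. -/
def bin (a : ℕ → ℝ) (l : ℕ) : Set ℝ := Ico (a l) (a (l + 1))

lemma IsUnitCut.intensity_bin (ha : IsUnitCut f a) (l : ℕ) : intensity f (bin a l) = 1 := by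
  rw [intensity, bin, withDensity_apply _ measurableSet_Ico, Measure.restrict_restrict
    measurableSet_Ico, inter_eq_self_of_subset_left
    (show Ico (a l) (a (l + 1)) ⊆ Ici 0 from fun t ht => (ha.nonneg l).trans ht.1), ha.mass]

variable {Ω : Type*} [MeasurableSpace Ω] {P : Measure Ω} {d : ℝ}
  {X : ℕ → Ω → ℝ} {W : ℕ → ℝ≥0 → Ω → ℝ}

/-- The largest excursion to the right of the frogs with label `o`. -/
noncomputable def binReach (d : ℝ) (a : ℕ → ℝ) (X : ℕ → Ω → ℝ) (W : ℕ → ℝ≥0 → Ω → ℝ)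
    (o : Option ℕ) (ω : Ω) : ℝ≥0∞ :=
  reach (bin a) (fun n => X n ω) (fun i => pathSup d fun t => W i t ω) o

lemma IsFrogInput.measurable_pathSup (h : IsFrogInput f X W P) (d : ℝ) (i : ℕ) :
    Measurable fun ω => pathSup d fun t => W i t ω :=
  (FrogModel.measurable_pathSup d).comp (measurable_pi_lambda _ (h.measurable i))

lemma IsFrogInput.measurable_binReach (h : IsFrogInput f X W P) (d : ℝ) (a : ℕ → ℝ)
    (o : Option ℕ) : Measurable (binReach d a X W o) :=
  measurable_reach (fun _ => measurableSet_Ico) h.poisson.measurable (h.measurable_pathSup d) o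

/-- The distribution function of the exponential law with parameter `2 d`. -/
noncomputable def expCdf (d : ℝ) (c : ℝ≥0∞) : ℝ :=
  if c = ∞ then 1 else 1 - Real.exp (-(2 * d * c.toReal))

lemma expCdf_nonneg (hd : 0 < d) (c : ℝ≥0∞) : 0 ≤ expCdf d c := by
  rw [expCdf]
  split_ifs
  · exact zero_le_one
  · have : 0 ≤ 2 * d * c.toReal := by positivity
    linarith [Real.exp_le_one_iff.2 (neg_nonpos.2 this)]

lemma expCdf_ofReal {r : ℝ} (hr : 0 ≤ r) :
    expCdf d (ENNReal.ofReal r) = 1 - Real.exp (-(2 * d * r)) := by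
  rw [expCdf, if_neg ENNReal.ofReal_ne_top, ENNReal.toReal_ofReal hr]

lemma IsFrogInput.measure_pathSup_le [IsProbabilityMeasure P] (h : IsFrogInput f X W P)
    (hd : 0 < d) (i : ℕ) (c : ℝ≥0∞) :
    P {ω | pathSup d (fun t => W i t ω) ≤ c} = ENNReal.ofReal (expCdf d c) := by
  rcases eq_or_ne c ∞ with rfl | hc
  · simp [expCdf]
  · have := FrogModel.measure_pathSup_le (h.brownian i) (h.measurable i) hd
      (ENNReal.toReal_nonneg (a := c))
    rw [ENNReal.ofReal_toReal hc] at this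
    rw [this, expCdf, if_neg hc]

lemma IsFrogInput.hasLaw_count (h : IsFrogInput f X W P) (ha : IsUnitCut f a) (l : ℕ) :
    HasLaw (fun ω => pointCount (fun n => X n ω) (bin a l))
      ((poissonMeasure 1).map (Nat.cast : ℕ → ℕ∞)) P := by
  have := h.poisson.count_law (bin a l) measurableSet_Ico
    (by rw [ha.intensity_bin]; exact ENNReal.one_ne_top)
  rwa [ha.intensity_bin, ENNReal.toNNReal_one] at this

lemma IsFrogInput.iIndepFun_count (h : IsFrogInput f X W P) (ha : IsUnitCut f a) :
    iIndepFun (fun l ω => pointCount (fun n => X n ω) (bin a l)) P := by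
  rw [iIndepFun_iff_finset]
  intro s
  have h1 := h.poisson.count_indep s.card (fun k => bin a (s.equivFin.symm k))
    (fun _ => measurableSet_Ico) fun k l hkl =>
      pairwise_disjoint_Ico_bins ha.strictMono fun heq =>
        hkl (s.equivFin.symm.injective (Subtype.ext heq))
  have h2 := h1.precomp s.equivFin.injective
  convert h2 using 3 with l
  simp

lemma IsFrogInput.iIndepFun_pathSup (h : IsFrogInput f X W P) (d : ℝ) :
    iIndepFun (fun i ω => pathSup d fun t => W i t ω) P :=
  h.indep.comp (fun _ => pathSup d) fun _ => FrogModel.measurable_pathSup d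

lemma IsFrogInput.indepFun_pathSup (h : IsFrogInput f X W P) (d : ℝ) :
    IndepFun (fun ω n => X n ω) (fun ω i => pathSup d fun t => W i t ω) P := by
  have hψ : Measurable fun (w : ℕ → ℝ≥0 → ℝ) i => pathSup d (w i) :=
    measurable_pi_lambda _ fun i => (FrogModel.measurable_pathSup d).comp (measurable_pi_apply i)
  have := h.indep_poisson.comp measurable_id hψ
  rwa [Function.id_comp] at this

lemma IsFrogInput.iIndepFun_binReach [IsProbabilityMeasure P]
    (h : IsFrogInput f X W P) (ha : IsUnitCut f a)
    (hd : 0 < d) : iIndepFun (binReach d a X W) P :=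
  iIndepFun_reach (fun _ => measurableSet_Ico) (pairwise_disjoint_Ico_bins ha.strictMono)
    h.poisson.measurable (h.measurable_pathSup d) (h.indepFun_pathSup d) (h.iIndepFun_pathSup d)
    (expCdf_nonneg hd) (h.measure_pathSup_le hd) (h.hasLaw_count ha) (h.iIndepFun_count ha)

lemma IsFrogInput.measure_binReach_some_le [IsProbabilityMeasure P]
    (h : IsFrogInput f X W P) (ha : IsUnitCut f a)
    (hd : 0 < d) (l : ℕ) (c : ℝ≥0∞) : P {ω | binReach d a X W (some l) ω ≤ c} =
      ENNReal.ofReal (Real.exp (-(1 - expCdf d c))) := by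
  have := measure_reach_some_le (I := bin a) (fun _ => measurableSet_Ico)
    (pairwise_disjoint_Ico_bins ha.strictMono)
    h.poisson.measurable (h.measurable_pathSup d) (h.indepFun_pathSup d) (h.iIndepFun_pathSup d)
    (expCdf_nonneg hd) (h.measure_pathSup_le hd) (h.hasLaw_count ha) (h.iIndepFun_count ha) l c
  rwa [NNReal.coe_one, one_mul] at this

/-- The probability that no interval `l < k` reaches further than `c l`. -/
lemma IsFrogInput.measure_gapEvent [IsProbabilityMeasure P]
    (h : IsFrogInput f X W P) (ha : IsUnitCut f a)
    (hd : 0 < d) {c : ℕ → ℕ → ℝ} (k : ℕ) (hc : ∀ l < k, 0 ≤ c k l) :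
    P (gapEvent (fun l => binReach d a X W (some l)) (fun k l => ENNReal.ofReal (c k l)) k) =
      ENNReal.ofReal (Real.exp (-∑ l ∈ Finset.range k, Real.exp (-(2 * d * c k l)))) := by
  rw [FrogModel.measure_gapEvent ((h.iIndepFun_binReach ha hd).precomp (Option.some_injective ℕ))
    (h.measure_binReach_some_le ha hd), ← Finset.sum_neg_distrib, Real.exp_sum,
    ENNReal.ofReal_prod_of_nonneg fun _ _ => (Real.exp_pos _).le]
  refine Finset.prod_congr rfl fun l hl => ?_
  rw [expCdf_ofReal (hc l (Finset.mem_range.1 hl)), sub_sub_cancel]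

/-- The almost sure properties of the input on which the dynamics depends. -/
structure IsRegular (d : ℝ) (a : ℕ → ℝ) (x : ℕ → ℝ) (w : ℕ → ℝ≥0 → ℝ) : Prop where
  strictMono : StrictMono x
  nonneg : ∀ n, 0 ≤ x n
  finite_bin : ∀ l, {n | x n ∈ bin a l}.Finite
  continuous : ∀ i, Continuous (w i)
  zero : ∀ i, w i 0 = 0
  unbounded : ∀ i (y : ℝ), ∃ u : ℝ≥0, w i u - d * u < y
  pathSup_zero_ne_top : pathSup d (w 0) ≠ ∞

lemma IsFrogInput.ae_isRegular [IsProbabilityMeasure P]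
    (h : IsFrogInput f X W P) (ha : IsUnitCut f a) (hd : 0 < d) :
    ∀ᵐ ω ∂P, IsRegular d a (fun n => X n ω) (fun i t => W i t ω) := by
  have hnonneg : ∀ᵐ ω ∂P, ∀ n, 0 ≤ X n ω := by
    have h0 : intensity f (Iio 0) = 0 := by
      rw [intensity, withDensity_apply _ measurableSet_Iio, Measure.restrict_restrict
        measurableSet_Iio]
      have : Iio (0 : ℝ) ∩ Ici 0 = ∅ := by
        ext t; simp
      rw [this, Measure.restrict_empty, lintegral_zero_measure]
    have hlaw := h.poisson.count_law (Iio 0) measurableSet_Iio (by rw [h0]; exact ENNReal.zero_ne_top)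
    rw [h0, ENNReal.toNNReal_zero] at hlaw
    have hz : ∀ᵐ n ∂((poissonMeasure 0).map (Nat.cast : ℕ → ℕ∞)), n = 0 := by
      rw [ae_map_iff (by fun_prop) MeasurableSet.of_discrete, ae_iff_of_countable]
      intro n hn
      by_contra hne
      refine hn ?_
      have hn0 : n ≠ 0 := fun h => hne (by simp [h])
      rw [poissonMeasure_singleton]
      simp [hn0]
    filter_upwards [(hlaw.ae_iff (p := fun n => n = 0) Measurable.of_discrete).2 hz] with ω hω n
    have := Set.encard_eq_zero.1 hω
    by_contra! hneg
    exact (Set.eq_empty_iff_forall_notMem.1 this n) hneg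
  have hfin : ∀ᵐ ω ∂P, ∀ l, {n | X n ω ∈ bin a l}.Finite := by
    refine ae_all_iff.2 fun l => ?_
    have : ∀ᵐ n ∂((poissonMeasure 1).map (Nat.cast : ℕ → ℕ∞)), n ≠ ⊤ := by
      rw [ae_map_iff (by fun_prop) (MeasurableSet.of_discrete)]
      exact ae_of_all _ fun n => ENat.natCast_ne_top n
    filter_upwards [((h.hasLaw_count ha l).ae_iff (p := fun n => n ≠ ⊤)
      Measurable.of_discrete).2 this] with ω hω
    exact Set.encard_ne_top_iff.1 hω
  have hsup : ∀ᵐ ω ∂P, pathSup d (fun t => W 0 t ω) ≠ ∞ := by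
    rw [ae_iff]
    have hb : ∀ n : ℕ, P {ω | ¬ pathSup d (fun t => W 0 t ω) ≠ ∞} ≤
        ENNReal.ofReal (Real.exp (-(2 * d * n))) := fun n => by
      rw [← measure_lt_pathSup (h.brownian 0) (h.measurable 0) hd n.cast_nonneg]
      refine measure_mono fun ω hω => ?_
      simp only [ne_eq, not_not, mem_ofPred_eq] at hω ⊢
      rw [hω]
      exact ENNReal.ofReal_lt_top
    have hlim : Tendsto (fun n : ℕ => ENNReal.ofReal (Real.exp (-(2 * d * n)))) atTop (𝓝 0) := by
      rw [← ENNReal.ofReal_zero]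
      exact (ENNReal.continuous_ofReal.tendsto 0).comp (Real.tendsto_exp_atBot.comp
        (tendsto_neg_atTop_atBot.comp
          (tendsto_natCast_atTop_atTop.const_mul_atTop (by positivity))))
    exact le_antisymm (ge_of_tendsto' hlim hb) zero_le
  filter_upwards [h.poisson.strictMono, hnonneg, hfin, ae_all_iff.2 fun i => (h.brownian i).cont,
    ae_all_iff.2 fun i => (h.brownian i).eval_zero_ae_eq_zero, ae_all_iff.2 fun i =>
      ae_exists_drifted_lt (h.brownian i).toIsPreBrownianReal (h.measurable i) hd, hsup]
    with ω h1 h2 h3 h4 h5 h6 h7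
  exact ⟨h1, h2, h3, h4, h5, h6, h7⟩

omit [MeasurableSpace Ω] in
lemma start_nonneg {ω : Ω} (h : ∀ n, 0 ≤ X n ω) (j : ℕ) : 0 ≤ start X ω j := by
  rcases j with _ | j
  exacts [le_rfl, h j]

omit [MeasurableSpace Ω] in
lemma IsRegular.hitsOrigin_iff {ω : Ω} (h : IsRegular d a (fun n => X n ω) (fun i t => W i t ω))
    (j : ℕ) : HitsOrigin (start X ω) (displacement d W ω) j ↔
      activationTime (start X ω) (displacement d W ω) j ≠ ∞ := by
  have hc := h.continuous j
  refine FrogModel.hitsOrigin_iff (start_nonneg h.nonneg j) ?_ ?_ (h.unbounded j _)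
  · unfold displacement; fun_prop
  · simp [displacement, h.zero j]

omit [MeasurableSpace Ω] in
/-- A gap at an interval beyond the reach of frog `0` stops the spread of activity for good. -/
lemma IsRegular.finite_of_gapEvent {ω : Ω} (ha : IsUnitCut f a)
    (h : IsRegular d a (fun n => X n ω) (fun i t => W i t ω)) {k : ℕ}
    (hk : (pathSup d fun t => W 0 t ω).toReal < a k)
    (hgap : ω ∈ gapEvent (fun l => binReach d a X W (some l))
      (fun k l => ENNReal.ofReal (a k - a (l + 1))) k) :
    {j | HitsOrigin (start X ω) (displacement d W ω) j}.Finite := by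
  have hak : 0 < a k := ENNReal.toReal_nonneg.trans_lt hk
  have hlt_bin : ∀ n l, X n ω < a k → X n ω ∈ bin a l → l < k := fun n l hn hl =>
    ha.strictMono.lt_iff_lt.1 (hl.1.trans_lt hn)
  have hreach : ∀ i, start X ω i < a k → ∀ u, start X ω i + displacement d W ω i u < a k := by
    rintro (_ | i) hi u
    · have := le_of_pathSup_le (h.continuous 0) ENNReal.toReal_nonneg
        (ENNReal.ofReal_toReal h.pathSup_zero_ne_top).ge u
      simp only [start, displacement] at *
      linarith
    · simp only [start, displacement] at *
      obtain ⟨l, hl⟩ := ha.exists_mem (h.nonneg i)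
      have hlk := hlt_bin i l hi hl
      have h1 := reach_some_le_iff.1 (hgap l hlk) i hl
      have h2 := le_of_pathSup_le (h.continuous (i + 1))
        (sub_nonneg.2 (ha.strictMono.monotone hlk)) h1 u
      have h3 : X i ω < a (l + 1) := hl.2
      linarith
  have hfin : {n | X n ω < a k}.Finite := by
    refine ((Finset.range k).finite_toSet.biUnion fun l _ => h.finite_bin l).subset fun n hn => ?_
    obtain ⟨l, hl⟩ := ha.exists_mem (h.nonneg n)
    exact mem_iUnion₂.2 ⟨l, Finset.mem_coe.2 (Finset.mem_range.2 (hlt_bin n l hn hl)), hl⟩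
  refine ((finite_singleton 0).union (hfin.image Nat.succ)).subset fun j hj => ?_
  have hact := (h.hitsOrigin_iff j).1 hj
  have hj' : start X ω j < a k := by
    by_contra! hle
    exact hact (activationTime_eq_top (by exact hak) hreach hle)
  rcases j with _ | j
  · exact Or.inl rfl
  · exact Or.inr ⟨j, hj', rfl⟩

omit [MeasurableSpace Ω] in
/-- If frog `0` covers the first `K` intervals and each later interval is covered completely by a
frog that starts in an earlier one, then all frogs are woken. -/
lemma IsRegular.infinite_of_covered {ω : Ω} (ha : IsUnitCut f a)
    (h : IsRegular d a (fun n => X n ω) (fun i t => W i t ω)) {K : ℕ}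
    (hK : ENNReal.ofReal (a K) < pathSup d fun t => W 0 t ω)
    (hcov : ∀ k, ω ∉ gapEvent (fun l => binReach d a X W (some l))
      (fun k l => ENNReal.ofReal (a (k + 1) - a l)) (k + K)) :
    {j | HitsOrigin (start X ω) (displacement d W ω) j}.Infinite := by
  have hmono : ∀ i j, i ≤ j → start X ω i ≤ start X ω j := by
    rintro (_ | i) (_ | j) hij
    · exact le_rfl
    · exact h.nonneg j
    · omega
    · exact h.strictMono.monotone (Nat.le_of_succ_le_succ hij)
  have hall : ∀ j, activationTime (start X ω) (displacement d W ω) j ≠ ∞ := by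
    refine activationTime_ne_top (fun i => ?_) (fun i => ?_) hmono ?_
    · have := h.continuous i
      unfold displacement; fun_prop
    · simp [displacement, h.zero i]
    · rintro (_ | j) hj
      · exact absurd rfl hj
      · obtain ⟨k, hk⟩ := ha.exists_mem (h.nonneg j)
        rcases lt_or_ge k K with hkK | hkK
        · obtain ⟨u, hu⟩ := exists_lt_of_lt_pathSup (ha.nonneg K) hK
          refine ⟨0, Nat.succ_pos j, u, ?_⟩
          have h1 : X j ω < a (k + 1) := hk.2
          have h2 : a (k + 1) ≤ a K := ha.strictMono.monotone hkK
          simp only [start, displacement]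
          linarith
        · have h1 := hcov (k - K)
          rw [Nat.sub_add_cancel hkK] at h1
          simp only [gapEvent, mem_ofPred_eq, not_forall, not_le] at h1
          obtain ⟨l, hlk, h1⟩ := h1
          obtain ⟨i, hi, h2⟩ := lt_reach_some_iff.1 h1
          have hlk' : a (l + 1) ≤ a k := ha.strictMono.monotone hlk
          have hkk : a k < a (k + 1) := ha.strictMono (Nat.lt_succ_self k)
          have hll : a l < a (l + 1) := ha.strictMono (Nat.lt_succ_self l)
          obtain ⟨u, hu⟩ := exists_lt_of_lt_pathSup (by linarith) h2
          have h3 : X i ω < a (l + 1) := hi.2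
          have h4 : a l ≤ X i ω := hi.1
          have h5 : a k ≤ X j ω := hk.1
          have h6 : X j ω < a (k + 1) := hk.2
          refine ⟨i + 1, Nat.succ_lt_succ (h.strictMono.lt_iff_lt.1 (by linarith)), u, ?_⟩
          simp only [start, displacement]
          linarith
  have : {j | HitsOrigin (start X ω) (displacement d W ω) j} = univ :=
    eq_univ_of_forall fun j => (h.hitsOrigin_iff j).2 (hall j)
  rw [this]
  exact infinite_univ

/-- Gaps occur arbitrarily late, in particular beyond the reach of frog `0`. -/
lemma IsFrogInput.transient_of_not_summable [IsProbabilityMeasure P]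
    (h : IsFrogInput f X W P) (ha : IsUnitCut f a)
    (hd : 0 < d) (hf_nonneg : ∀ t, 0 ≤ t → 0 ≤ f t) (hf_mono : MonotoneOn f (Ici 0))
    (hs : ¬ Summable fun k => Real.exp (-(f (a k) / (2 * d)))) : Transient d X W P := by
  have hanti := ha.antitone hf_nonneg hf_mono
  let R : ℕ → Ω → ℝ≥0∞ := fun l => binReach d a X W (some l)
  let b : ℕ → ℕ → ℝ≥0∞ := fun k l => ENNReal.ofReal (a k - a (l + 1))
  have hsum : ∑' k, P (gapEvent R b k) = ∞ := by
    by_contra hne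
    refine hs ?_
    have h1 := ENNReal.summable_toReal hne
    refine (summable_mul_left_iff (Real.exp_pos (-1)).ne').1
      (Summable.of_nonneg_of_le (fun k => by positivity) (fun k => ?_) h1)
    rw [h.measure_gapEvent ha hd (c := fun k l => a k - a (l + 1)) k fun l hl =>
      sub_nonneg.2 (ha.strictMono.monotone hl), ENNReal.toReal_ofReal (Real.exp_pos _).le]
    exact exp_neg_le_exp_neg_sum (y := fun k => f (a k)) ha.strictMono hanti (by positivity)
      (fun k => hf_nonneg _ (ha.nonneg k)) (fun k => (ha.gap_bounds hf_nonneg hf_mono k).2) k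
  have hlate := fun K => ae_exists_gapEvent (R := R) (b := b)
    ((h.iIndepFun_binReach ha hd).precomp (Option.some_injective ℕ))
    (fun l => h.measurable_binReach d a (some l)) (h.measure_binReach_some_le ha hd)
    (fun k m l hlm => ENNReal.ofReal_le_ofReal (sub_shift_le hanti k hlm)) hsum K
  have : ∀ᵐ ω ∂P, ¬ {j | HitsOrigin (start X ω) (displacement d W ω) j}.Infinite := by
    filter_upwards [ae_all_iff.2 hlate, h.ae_isRegular ha hd] with ω hω hreg
    obtain ⟨K, hK⟩ := (ha.tendsto.eventually_gt_atTop
      (pathSup d fun t => W 0 t ω).toReal).exists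
    obtain ⟨k, hkK, hk⟩ := hω K
    exact not_infinite.2
      (hreg.finite_of_gapEvent ha (hK.trans_le (ha.strictMono.monotone hkK)) hk)
  rw [ae_iff] at this
  simpa [Transient] using this

/-- The reach of frog `0` is independent of the events that an interval is left uncovered by the
sleeping frogs, and with positive probability frog `0` makes up for the first `K` intervals. -/
lemma IsFrogInput.not_transient_of_summable [IsProbabilityMeasure P]
    (h : IsFrogInput f X W P) (ha : IsUnitCut f a)
    (hd : 0 < d) (hf_nonneg : ∀ t, 0 ≤ t → 0 ≤ f t) (hf_mono : MonotoneOn f (Ici 0))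
    (hs : Summable fun k => Real.exp (-(f (a k) / (2 * d)))) : ¬ Transient d X W P := by
  have hanti := ha.antitone hf_nonneg hf_mono
  let b : ℕ → ℕ → ℝ≥0∞ := fun k l => ENNReal.ofReal (a (k + 1) - a l)
  let F : ℕ → Set Ω := gapEvent (fun l => binReach d a X W (some l)) b
  have hF : ∀ k, P (F k) = ENNReal.ofReal
      (Real.exp (-∑ l ∈ Finset.range k, Real.exp (-(2 * d * (a (k + 1) - a l))))) := fun k =>
    h.measure_gapEvent ha hd (c := fun k l => a (k + 1) - a l) k fun l hl =>
      sub_nonneg.2 (ha.strictMono.monotone (hl.le.trans (Nat.le_succ k)))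
  have hFsum : ∑' k, P (F k) ≠ ∞ := by
    simp_rw [hF]
    exact (summable_exp_neg_sum (y := fun k => f (a k)) ha.strictMono hanti (by positivity)
      (fun k => (ha.gap_bounds hf_nonneg hf_mono k).1) hs).tsum_ofReal_ne_top
  obtain ⟨K, hK⟩ := ((ENNReal.tendsto_sum_nat_add _ hFsum).eventually
    (gt_mem_nhds zero_lt_one) : ∀ᶠ K in atTop, ∑' k, P (F (k + K)) < 1).exists
  let E : Set Ω := {ω | ENNReal.ofReal (a K) < pathSup d fun t => W 0 t ω}
  have hE : P E = ENNReal.ofReal (Real.exp (-(2 * d * a K))) :=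
    measure_lt_pathSup (h.brownian 0) (h.measurable 0) hd (ha.nonneg K)
  have hEpos : P E ≠ 0 := by
    rw [hE]; exact (ENNReal.ofReal_pos.2 (Real.exp_pos _)).ne'
  have hindep : ∀ k, P (E ∩ F k) = P E * P (F k) := by
    intro k
    have hI := h.iIndepFun_binReach ha hd
    let t : Option ℕ → Set ℝ≥0∞ := fun o => o.elim (Ioi (ENNReal.ofReal (a K))) fun l => Iic (b k l)
    have ht : ∀ o, MeasurableSet (t o) := by
      rintro (_ | l)
      exacts [measurableSet_Ioi, measurableSet_Iic]
    have hE' : binReach d a X W none ⁻¹' t none = E := by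
      ext ω
      simp [t, E, binReach, reach_none]
    have hF' : (⋂ o ∈ (Finset.range k).map Function.Embedding.some,
        binReach d a X W o ⁻¹' t o) = F k := by
      ext ω
      simp [t, F, gapEvent]
    have h1 := hI.measure_inter_preimage_eq_mul (Finset.range k).insertNone fun o _ => ht o
    have h2 := hI.measure_inter_preimage_eq_mul
      ((Finset.range k).map Function.Embedding.some) fun o _ => ht o
    rw [hF', Finset.prod_map] at h2
    rw [Finset.prod_insertNone, hE'] at h1
    rw [h2]
    refine Eq.trans ?_ h1
    congr 1
    rw [← hE', ← hF']
    ext ω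
    simp [Finset.mem_insertNone, Option.forall]
  have hbad : P (E ∩ ⋃ k, F (k + K)) < P E := by
    rw [inter_iUnion]
    calc P (⋃ k, E ∩ F (k + K)) ≤ ∑' k, P (E ∩ F (k + K)) := measure_iUnion_le _
      _ = P E * ∑' k, P (F (k + K)) := by simp_rw [hindep]; exact ENNReal.tsum_mul_left
      _ < P E * 1 := ENNReal.mul_lt_mul_right hEpos (measure_ne_top _ _) hK
      _ = P E := mul_one _
  have hgood : P (E \ ⋃ k, F (k + K)) ≠ 0 := by
    intro hzero
    refine absurd hbad (not_lt.2 ?_)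
    calc P E ≤ P (E ∩ ⋃ k, F (k + K)) + P (E \ ⋃ k, F (k + K)) := measure_le_inter_add_sdiff _ _ _
      _ = _ := by rw [hzero, add_zero]
  intro htr
  refine hgood (measure_mono_null_ae ?_ htr)
  filter_upwards [h.ae_isRegular ha hd] with ω hreg hω
  exact hreg.infinite_of_covered ha hω.1 fun k hk => hω.2 (mem_iUnion.2 ⟨k, hk⟩)

end Assembly

end FrogModel

theorem theorem1 {Ω : Type*} [MeasurableSpace Ω] (P : Measure Ω) [IsProbabilityMeasure P]
    (drift : ℝ) (hdrift : 0 < drift)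
    (f : ℝ → ℝ) (hf_nonneg : ∀ t, 0 ≤ t → 0 ≤ f t) (hf_mono : MonotoneOn f (Ici 0))
    (hf_ne : ∃ t, 0 ≤ t ∧ f t ≠ 0)
    (X : ℕ → Ω → ℝ) (W : ℕ → ℝ≥0 → Ω → ℝ) (hXW : FrogModel.IsFrogInput f X W P) :
    FrogModel.Transient drift X W P ↔
      ∫⁻ t in Ici (0 : ℝ), ENNReal.ofReal (Real.exp (-(f t) / (2 * drift)) * f t) = ∞ := by
  obtain ⟨a, h0, hmono, htop, hmass⟩ := FrogModel.exists_bins hf_nonneg hf_mono hf_ne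
  have ha : FrogModel.IsUnitCut f a := ⟨h0, hmono, htop, hmass⟩
  rw [FrogModel.lintegral_eq_top_iff_not_summable hf_mono h0 hmono htop hmass (by positivity)]
  refine ⟨fun htr hs => ?_, hXW.transient_of_not_summable ha hdrift hf_nonneg hf_mono⟩
  exact hXW.not_transient_of_summable ha hdrift hf_nonneg hf_mono hs htr
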